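/- Let $n\ge 1$ and let $G_n\subset\mathbb{R}^2$ be a bouquet of $n$ circles: the union of $C^1$ regular simple closed curves $S_1,\dots,S_n$ which are pairwise disjoint except for a single common point $b$, at which they are all tangent, and which carry orientations that agree at $b$ (for instance nested circles touching at $b$, all oriented anticlockwise). Let $\mathcal{M}^n$ be the class of continuous maps $f:G_n\to G_n$ such that (1) $f$ is $C^1$ on $G_n\setminus\{b\}$ (as a map into the plane); (2) for every $m\ge 1$ and every $x\in G_n\setminus\{b\}$ with $f^m(x)=x$, $|Df^m(x)|>1$ (this is required whenever $f^m$ is differentiable at $x$, which can fail only if the orbit of $x$ passes through $b$); (3) the derivative of $f$ along the circles, taken with respect to their orientations, is nonzero and has the same sign at all points of $G_n\setminus\{b\}$. The topological entropy is $h(f)=\sup_{\mathcal A}\lim_{m\to\infty}\frac1m\log\mathcal N\big(\mathcal A\vee f^{-1}\mathcal A\vee\dots\vee f^{-(m-1)}\mathcal A\big)$, where $\mathcal A$ runs over the open covers of $G_n$ and $\mathcal N$ is the minimal cardinality of a subcover. Let $f\in\mathcal{M}^n$ and let $f_{*1}:H_1(G_n;\mathbb{Q})\to H_1(G_n;\mathbb{Q})$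 be the induced map on first rational homology. The classes $a_1,\dots,a_n$ of the oriented circles (the images of one fixed generator of $H_1(\mathbb{R}/\mathbb{Z};\mathbb{Q})$ under the parametrizations of $S_1,\dots,S_n$) form a basis of $H_1(G_n;\mathbb{Q})$. Write $\|f_{*1}^m\|$ for the sum of the absolute values of the entries of the matrix of $f_{*1}^m$ in this basis, and $\sigma(f_{*1})$ for the largest modulus of the complex eigenvalues of $f_{*1}$. Then (a) $h(f)=\lim_{m\to\infty}\frac1m\log\|f_{*1}^m\|$ (in particular the limit exists); (b) $h(f)=\log\sigma(f_{*1})$. -/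

import Mathlib

noncomputable section

/-! ### Topological entropy through open covers -/

section Entropy

variable {X : Type*}

/-- The minimal cardinality `N(A)` of a subcover of `X` chosen from `A`
(it is `⊤` if there is no finite subcover). -/
def minSubcoverCard (A : Set (Set X)) : ℕ∞ :=
  ⨅ (B : Set (Set X)) (_ : B ⊆ A ∧ ⋃₀ B = Set.univ), B.encard

/-- The refined cover `A ∨ f⁻¹(A) ∨ … ∨ f^{-(m-1)}(A)`: all nonempty sets
`A₀ ∩ f⁻¹(A₁) ∩ … ∩ f^{-(m-1)}(A_{m-1})` with every `Aₖ` in `A`. -/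
def iteratedCover (f : X → X) (A : Set (Set X)) (m : ℕ) : Set (Set X) :=
  {s | s.Nonempty ∧ ∃ a : Fin m → Set X, (∀ k, a k ∈ A) ∧ s = ⋂ k : Fin m, f^[(k : ℕ)] ⁻¹' a k}

/-- `h(f, A) = lim (1/m) log N(A^m)`. The limit exists by subadditivity, so that it is the upper
limit written here. `ENNReal.log` is the extended logarithm, with `log 0 = ⊥` and `log ⊤ = ⊤`. -/
def coverEntropyOf (f : X → X) (A : Set (Set X)) : EReal :=
  Filter.limsup
    (fun m : ℕ => ENNReal.log ((minSubcoverCard (iteratedCover f A m) : ℕ∞) : ENNReal) / (m : EReal))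
    Filter.atTop

/-- The topological entropy `h(f)`: the supremum of `h(f, A)` over all open covers `A` of `X`. -/
def topologicalEntropy [TopologicalSpace X] (f : X → X) : EReal :=
  ⨆ (A : Set (Set X)) (_ : (∀ a ∈ A, IsOpen a) ∧ ⋃₀ A = Set.univ), coverEntropyOf f A

end Entropy

/-! ### First rational homology, norm of a matrix, spectral radius -/

/-- The first singular homology group `H₁(X; ℚ)`, as a rational vector space. -/
abbrev RatH1 (X : Type) [TopologicalSpace X] : ModuleCat.{0} ℚ :=
  ((AlgebraicTopology.singularHomologyFunctor (ModuleCat.{0} ℚ) 1).obj (ModuleCat.of ℚ ℚ)).obj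
    (TopCat.of X)

/-- The linear map `f_{*1} : H₁(X; ℚ) → H₁(Y; ℚ)` induced by a continuous map `f`. -/
def RatH1.map {X Y : Type} [TopologicalSpace X] [TopologicalSpace Y] (f : C(X, Y)) :
    RatH1 X →ₗ[ℚ] RatH1 Y :=
  (((AlgebraicTopology.singularHomologyFunctor (ModuleCat.{0} ℚ) 1).obj (ModuleCat.of ℚ ℚ)).map
    (TopCat.ofHom f)).hom

/-- `‖M‖`, the sum of the absolute values of the entries of `M`. -/
def entrySum {n : ℕ} (M : Matrix (Fin n) (Fin n) ℚ) : ℝ :=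
  ∑ i, ∑ j, |(M i j : ℝ)|

/-- The spectral radius `σ(L)` of a linear map of a finite-dimensional rational vector space: the
largest modulus of its complex eigenvalues, that is, of the eigenvalues of its complexification. -/
def eigenvalueRadius {V : Type*} [AddCommGroup V] [Module ℚ V] (L : V →ₗ[ℚ] V) : ENNReal :=
  ⨆ (μ : ℂ) (_ : Module.End.HasEigenvalue (L.baseChange ℂ) μ), ‖μ‖ₑ

/-! ### Bouquets of circles in the plane -/

/-- A bouquet `Gₙ` of `n` circles in the plane: `C¹` regular simple closed curves, pairwise disjoint
except for one common point `b`, at which they all touch (are tangent). The curve number `i` is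
given by a parametrization over `ℝ/ℤ` which starts at `b`, and the orientations of the curves agree
at `b`, as those of nested circles with the anticlockwise orientation do. -/
structure Bouquet (n : ℕ) where
  /-- the branching point -/
  b : EuclideanSpace ℝ (Fin 2)
  /-- the oriented circles `S₁, …, Sₙ` -/
  circle : Fin n → UnitAddCircle → EuclideanSpace ℝ (Fin 2)
  circle_zero : ∀ i, circle i 0 = b
  circle_injective : ∀ i, Function.Injective (circle i)
  contDiff_circle : ∀ i, ContDiff ℝ 1 (fun t : ℝ => circle i (t : UnitAddCircle))
  deriv_circle_ne_zero : ∀ i (t : ℝ), deriv (fun u : ℝ => circle i (u : UnitAddCircle)) t ≠ 0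
  range_inter_range : ∀ i j, i ≠ j → Set.range (circle i) ∩ Set.range (circle j) = {b}
  tangent_at_b : ∀ i j, ∃ c : ℝ, 0 < c ∧
    deriv (fun u : ℝ => circle j (u : UnitAddCircle)) 0 =
      c • deriv (fun u : ℝ => circle i (u : UnitAddCircle)) 0

namespace Bouquet

variable {n : ℕ} (G : Bouquet n)

/-- The space `Gₙ`, the union of the circles, as a subspace of the plane. -/
abbrev Space : Type :=
  {x : EuclideanSpace ℝ (Fin 2) // ∃ i, x ∈ Set.range (G.circle i)}

theorem continuous_circle (i : Fin n) : Continuous (G.circle i) :=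
  continuous_coinduced_dom.mpr (G.contDiff_circle i).continuous

/-- The parametrized circle `Sᵢ` as a loop in `Gₙ`. -/
def loop (i : Fin n) : C(UnitAddCircle, G.Space) where
  toFun t := ⟨G.circle i t, i, t, rfl⟩
  continuous_toFun := (G.continuous_circle i).subtype_mk _

/-- The velocity at time `t` of the parametrization of `Sᵢ`; it points in the direction of the
orientation. -/
def velocity (i : Fin n) (t : ℝ) : EuclideanSpace ℝ (Fin 2) :=
  deriv (fun u : ℝ => G.circle i (u : UnitAddCircle)) t

/-- The curve `u ↦ g(Sⱼ(u))` in the plane, for a self-map `g` of `Gₙ`. -/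
def along (g : G.Space → G.Space) (j : Fin n) (u : ℝ) : EuclideanSpace ℝ (Fin 2) :=
  (g (G.loop j (u : UnitAddCircle)) : EuclideanSpace ℝ (Fin 2))

/-- The class `Mⁿ` of maps `f` of `Gₙ`. A point of `Gₙ` other than `b` is `Sⱼ(t)` for
exactly one `j` and exactly one `t ∈ (0, 1)`. -/
structure MemM (f : C(G.Space, G.Space)) : Prop where
  /-- `f` is `C¹` on `Gₙ \ {b}`. -/
  contDiffOn : ∀ j, ContDiffOn ℝ 1 (G.along f j) (Set.Ioo 0 1)
  /-- `|Df^m(x)| > 1` for all `m ≥ 1` and all fixed points `x ≠ b` of `f^m` (the only points at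
  which `f^m` might fail to have a derivative are those whose orbit passes through `b`). -/
  expanding : ∀ m : ℕ, 1 ≤ m → ∀ j, ∀ t ∈ Set.Ioo (0 : ℝ) 1,
    f^[m] (G.loop j (t : UnitAddCircle)) = G.loop j (t : UnitAddCircle) →
    ∀ D : ℝ, HasDerivAt (G.along f^[m] j) (D • G.velocity j t) t → 1 < |D|
  /-- The derivative of `f`, computed in coordinates of the circles which respect the orientations,
  has the same sign `ε = ± 1` at all points of `Gₙ \ {b}`. -/
  orientation : ∃ ε : ℝ, (ε = 1 ∨ ε = -1) ∧
    ∀ j, ∀ t ∈ Set.Ioo (0 : ℝ) 1, ∀ (i : Fin n) (s : ℝ),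
      f (G.loop j (t : UnitAddCircle)) = G.loop i (s : UnitAddCircle) →
      ∃ D : ℝ, 0 < ε * D ∧ HasDerivAt (G.along f j) (D • G.velocity i s) t

end Bouquet

end

/-! By the orientation hypothesis `f` moves along every circle in one direction `ε`. Collapse all
circles but the `i`-th to a point: the resulting coordinate of `f^[k]` along the `j`-th circle lifts
to a real function which is monotone in the direction `ε ^ k`. A monotone function has total
variation equal to its net increase, and the net increase over a full turn is a winding number,
namely the `(i, j)` entry of `B ^ k`, where `B` is the matrix of the map induced on homology. So
`entrySum (B ^ k)` is exactly the length, with multiplicity, of the image of the circles under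
`f^[k]`, and the entropy is compared with this length.

Upper bound (`exists_spanning`, `exists_card_le`): cut the circles into pieces on which the
variations of all iterates before time `m` add up to less than `δ`. About `δ⁻¹ ∑ k < m, entrySum (B
^ k)` pieces suffice, and one point of each follows every orbit. Lower bound (`abs_sub_lt`,
`exists_le_card`): two points of a half circle whose orbits stay close up to time `m` have close
real lifts at time `m`, because the lifts have no room to wrap around. A member of the iterated
cover thus carries little variation of `f^[m]`, and a number of members proportional to `entrySum (B
^ m)` is needed.

The partial sums in the upper bound grow no faster than the powers of any number above `σ`, because
`σ ≥ 1`: no circle is mapped to a point, so the nonnegative matrix `ε B` has column sums at least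
`1`. Gelfand's formula identifies the growth of `entrySum (B ^ m)` with `log σ`.

Two inputs support this. For the homology of a wedge of circles, winding numbers make the loop
classes independent; they span because, modulo their span, the class of a path depends only on its
end points. For the monotone lifts, the derivative condition away from `b` is turned into a
statement on small moves (`LocallyDirected`), which makes sense at `b` and is stable under
composition. -/

noncomputable section

/-! ### Singular 1-chains modulo boundaries -/

section SingularChains

open CategoryTheory Simplicial

variable {X Y : Type} [TopologicalSpace X] [TopologicalSpace Y]

/-- The rational singular chain complex of `X`. -/
abbrev ratChains (X : Type) [TopologicalSpace X] : ChainComplex (ModuleCat.{0} ℚ) ℕ :=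
  (TopCat.toSSet.obj (TopCat.of X)).chainComplex (ModuleCat.of ℚ ℚ)

/-- The chain map induced by a continuous map. -/
abbrev ratChainsMap (f : C(X, Y)) : ratChains X ⟶ ratChains Y :=
  SSet.chainComplexMap (TopCat.toSSet.map (TopCat.ofHom f)) (ModuleCat.of ℚ ℚ)

/-- A continuous map from the standard simplex as a simplex of the singular simplicial set. -/
def singularSimplex {n : ℕ} (σ : C(stdSimplex ℝ (Fin (n + 1)), X)) :
    (TopCat.toSSet.obj (TopCat.of X)) _⦋n⦌ :=
  (TopCat.toSSetObjEquiv (TopCat.of X) (.op ⦋n⦌)).symm σ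

theorem singularSimplex_surjective {n : ℕ} :
    Function.Surjective (singularSimplex (X := X) (n := n)) :=
  (TopCat.toSSetObjEquiv (TopCat.of X) (.op ⦋n⦌)).symm.surjective

/-- The inclusion of a face of the standard simplex. -/
def faceMap (n : ℕ) (i : Fin (n + 2)) :
    C(stdSimplex ℝ (Fin (n + 1)), stdSimplex ℝ (Fin (n + 2))) :=
  ⟨stdSimplex.map i.succAbove, stdSimplex.continuous_map _⟩

theorem δ_singularSimplex {n : ℕ} (σ : C(stdSimplex ℝ (Fin (n + 2)), X)) (i : Fin (n + 2)) :
    (TopCat.toSSet.obj (TopCat.of X)).δ i (singularSimplex σ) =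
      singularSimplex (σ.comp (faceMap n i)) :=
  rfl

/-- The chain given by one singular simplex. -/
def simplexChain {n : ℕ} (σ : C(stdSimplex ℝ (Fin (n + 1)), X)) : (ratChains X).X n :=
  ((TopCat.toSSet.obj (TopCat.of X)).ιChainComplex (R := ModuleCat.of ℚ ℚ)
    (singularSimplex σ)).hom (1 : ℚ)

theorem chains_hom_ext {n : ℕ} {T : Type} [AddCommGroup T] [Module ℚ T]
    {φ ψ : (ratChains X).X n →ₗ[ℚ] T}
    (h : ∀ σ, φ (simplexChain σ) = ψ (simplexChain σ)) : φ = ψ := by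
  suffices ModuleCat.ofHom (Y := ModuleCat.of ℚ T) φ = ModuleCat.ofHom (Y := ModuleCat.of ℚ T) ψ from
    congrArg ModuleCat.Hom.hom this
  refine SSet.chainComplex_hom_ext fun x => ?_
  obtain ⟨σ, rfl⟩ := singularSimplex_surjective x
  ext
  exact h σ

/-- A linear map out of the chains, from its values on the simplices. -/
def chainsDesc {n : ℕ} {T : Type} [AddCommGroup T] [Module ℚ T]
    (φ : C(stdSimplex ℝ (Fin (n + 1)), X) → T) : (ratChains X).X n →ₗ[ℚ] T :=
  ((SSet.isColimitChainComplexXCofan (TopCat.toSSet.obj (TopCat.of X)) (ModuleCat.of ℚ ℚ) n).desc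
    (Limits.Cofan.mk (ModuleCat.of ℚ T) fun x => ModuleCat.ofHom (LinearMap.toSpanSingleton ℚ T
      (φ (TopCat.toSSetObjEquiv (TopCat.of X) (.op ⦋n⦌) x))))).hom

theorem chainsDesc_simplexChain {n : ℕ} {T : Type} [AddCommGroup T] [Module ℚ T]
    (φ : C(stdSimplex ℝ (Fin (n + 1)), X) → T) (σ : C(stdSimplex ℝ (Fin (n + 1)), X)) :
    chainsDesc φ (simplexChain σ) = φ σ := by
  have h := (SSet.isColimitChainComplexXCofan (TopCat.toSSet.obj (TopCat.of X))
    (ModuleCat.of ℚ ℚ) n).fac (Limits.Cofan.mk (ModuleCat.of ℚ T) fun x => ModuleCat.ofHom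
      (LinearMap.toSpanSingleton ℚ T (φ (TopCat.toSSetObjEquiv (TopCat.of X) (.op ⦋n⦌) x))))
      ⟨singularSimplex σ⟩
  have h1 := congrArg (fun m => ModuleCat.Hom.hom m (1 : ℚ)) h
  refine h1.trans ?_
  change LinearMap.toSpanSingleton ℚ T (φ (TopCat.toSSetObjEquiv (TopCat.of X) (.op ⦋n⦌) (singularSimplex σ))) 1 = φ σ
  rw [LinearMap.toSpanSingleton_apply, one_smul, singularSimplex, Equiv.apply_symm_apply]

theorem d_simplexChain {n : ℕ} (σ : C(stdSimplex ℝ (Fin (n + 2)), X)) :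
    ((ratChains X).d (n + 1) n).hom (simplexChain σ) =
      ∑ i : Fin (n + 2), (-1 : ℤ) ^ i.val • simplexChain (σ.comp (faceMap n i)) := by
  have h := SSet.ιChainComplex_d (TopCat.toSSet.obj (TopCat.of X)) (ModuleCat.of ℚ ℚ)
    (singularSimplex σ)
  have h1 := congrArg (fun m => ModuleCat.Hom.hom m (1 : ℚ)) h
  refine h1.trans ?_
  simp only [δ_singularSimplex, simplexChain]
  simp [ModuleCat.hom_sum]

theorem d_simplexChain_two (τ : C(stdSimplex ℝ (Fin 3), X)) :
    ((ratChains X).d 2 1).hom (simplexChain τ) = simplexChain (τ.comp (faceMap 1 0)) -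
      simplexChain (τ.comp (faceMap 1 1)) + simplexChain (τ.comp (faceMap 1 2)) := by
  refine (d_simplexChain τ).trans ?_
  change ∑ i : Fin 3, _ = _
  rw [Fin.sum_univ_three]
  simp [sub_eq_add_neg]

/-- Singular 1-chains modulo boundaries. -/
abbrev OneChains (X : Type) [TopologicalSpace X] : ModuleCat.{0} ℚ := (ratChains X).opcycles 1

/-- The class of a singular 1-simplex modulo boundaries. -/
def pathClass (σ : C(stdSimplex ℝ (Fin 2), X)) : OneChains X :=
  ((ratChains X).pOpcycles 1).hom (simplexChain σ)

theorem oneChains_hom_ext {T : Type} [AddCommGroup T] [Module ℚ T] {φ ψ : OneChains X →ₗ[ℚ] T}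
    (h : ∀ σ, φ (pathClass σ) = ψ (pathClass σ)) : φ = ψ := by
  have h1 : φ ∘ₗ ((ratChains X).pOpcycles 1).hom = ψ ∘ₗ ((ratChains X).pOpcycles 1).hom :=
    chains_hom_ext h
  ext x
  obtain ⟨y, rfl⟩ := (ModuleCat.epi_iff_surjective ((ratChains X).pOpcycles 1)).1 inferInstance x
  exact LinearMap.congr_fun h1 y

/-- The boundary of `τ` is zero in the quotient. This is the only relation among path classes, as
`oneChainsDesc` shows. -/
theorem pathClass_triangle (τ : C(stdSimplex ℝ (Fin 3), X)) :
    pathClass (τ.comp (faceMap 1 1)) =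
      pathClass (τ.comp (faceMap 1 2)) + pathClass (τ.comp (faceMap 1 0)) := by
  have h := congrArg (fun m => ModuleCat.Hom.hom m (simplexChain τ)) ((ratChains X).d_pOpcycles 2 1)
  have h1 : ((ratChains X).pOpcycles 1).hom (((ratChains X).d 2 1).hom (simplexChain τ)) = 0 := h
  rw [d_simplexChain_two, map_add, map_sub] at h1
  change pathClass _ - pathClass _ + pathClass _ = 0 at h1
  rw [← sub_eq_zero, ← neg_eq_zero, ← h1]
  abel

/-- A linear map out of the 1-chains modulo boundaries. -/
def oneChainsDesc {T : Type} [AddCommGroup T] [Module ℚ T]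
    (φ : C(stdSimplex ℝ (Fin 2), X) → T)
    (h : ∀ τ : C(stdSimplex ℝ (Fin 3), X), φ (τ.comp (faceMap 1 1)) =
      φ (τ.comp (faceMap 1 2)) + φ (τ.comp (faceMap 1 0))) : OneChains X →ₗ[ℚ] T :=
  ((ratChains X).descOpcycles (A := ModuleCat.of ℚ T) (ModuleCat.ofHom (chainsDesc φ)) 2 (by simp)
    (by
      have h1 : chainsDesc φ ∘ₗ ((ratChains X).d 2 1).hom = 0 := by
        refine chains_hom_ext fun τ => ?_
        rw [LinearMap.comp_apply, d_simplexChain_two, map_add, map_sub]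
        simp [chainsDesc_simplexChain, h]
      ext x
      exact LinearMap.congr_fun h1 x)).hom

theorem oneChainsDesc_pathClass {T : Type} [AddCommGroup T] [Module ℚ T]
    (φ : C(stdSimplex ℝ (Fin 2), X) → T)
    (h : ∀ τ : C(stdSimplex ℝ (Fin 3), X), φ (τ.comp (faceMap 1 1)) =
      φ (τ.comp (faceMap 1 2)) + φ (τ.comp (faceMap 1 0))) (σ : C(stdSimplex ℝ (Fin 2), X)) :
    oneChainsDesc φ h (pathClass σ) = φ σ := by
  rw [← chainsDesc_simplexChain φ σ]
  refine congrArg (fun m => ModuleCat.Hom.hom m (simplexChain σ)) ((ratChains X).p_descOpcycles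
    (A := ModuleCat.of ℚ T) (ModuleCat.ofHom (chainsDesc φ)) 2 (by simp) _)

/-- The inclusion of the first homology into 1-chains modulo boundaries. -/
def homologyIncl (X : Type) [TopologicalSpace X] : RatH1 X →ₗ[ℚ] OneChains X :=
  ((ratChains X).homologyι 1).hom

theorem homologyIncl_injective : Function.Injective (homologyIncl X) :=
  (ModuleCat.mono_iff_injective ((ratChains X).homologyι 1)).1 inferInstance

/-- The map of 1-chains modulo boundaries induced by a continuous map. -/
def oneChainsMap (f : C(X, Y)) : OneChains X →ₗ[ℚ] OneChains Y :=
  (HomologicalComplex.opcyclesMap (ratChainsMap f) 1).hom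

theorem oneChainsMap_pathClass (f : C(X, Y)) (σ : C(stdSimplex ℝ (Fin 2), X)) :
    oneChainsMap f (pathClass σ) = pathClass (f.comp σ) := by
  have h := congrArg (fun m => ModuleCat.Hom.hom m (simplexChain σ))
    (HomologicalComplex.p_opcyclesMap (ratChainsMap f) 1)
  have h1 := congrArg (fun m => ModuleCat.Hom.hom m (1 : ℚ)) (SSet.ι_chainComplexMap_f _ _
    (TopCat.toSSet.map (TopCat.ofHom f)) (ModuleCat.of ℚ ℚ) (singularSimplex σ))
  exact h.trans (congrArg ((ratChains Y).pOpcycles 1).hom h1)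

theorem homologyIncl_map (f : C(X, Y)) (z : RatH1 X) :
    homologyIncl Y (RatH1.map f z) = oneChainsMap f (homologyIncl X z) :=
  congrArg (fun m => ModuleCat.Hom.hom m z) (HomologicalComplex.homologyι_naturality (ratChainsMap f) 1)

theorem fromOpcycles_pathClass (σ : C(stdSimplex ℝ (Fin 2), X)) :
    ((ratChains X).fromOpcycles 1 0).hom (pathClass σ) =
      simplexChain (σ.comp (faceMap 0 0)) - simplexChain (σ.comp (faceMap 0 1)) := by
  have h := congrArg (fun m => ModuleCat.Hom.hom m (simplexChain σ)) ((ratChains X).p_fromOpcycles 1 0)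
  refine h.trans ((d_simplexChain σ).trans ?_)
  simp [Fin.sum_univ_two, sub_eq_add_neg]

theorem exists_homologyIncl_eq {e : OneChains X}
    (h : ((ratChains X).fromOpcycles 1 0).hom e = 0) : ∃ z, homologyIncl X z = e := by
  have hk := (ratChains X).homologyIsKernel 1 0 (by simp)
  let s : ModuleCat.of ℚ ℚ ⟶ OneChains X := ModuleCat.ofHom (LinearMap.toSpanSingleton ℚ _ e)
  have hs : s ≫ (ratChains X).fromOpcycles 1 0 = 0 := by
    ext
    change ((ratChains X).fromOpcycles 1 0).hom ((1 : ℚ) • e) = 0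
    rw [one_smul, h]
  obtain ⟨l, hl⟩ := Limits.KernelFork.IsLimit.lift' hk s hs
  refine ⟨l.hom (1 : ℚ), ?_⟩
  have := congrArg (fun m => ModuleCat.Hom.hom m (1 : ℚ)) hl
  refine this.trans (one_smul ℚ e)

/-- If a singular 1-simplex is closed, its two end points agree as 0-simplices. -/
theorem comp_faceMap_zero_eq (σ : C(stdSimplex ℝ (Fin 2), X))
    (h : σ (stdSimplex.vertex 0) = σ (stdSimplex.vertex 1)) :
    σ.comp (faceMap 0 0) = σ.comp (faceMap 0 1) := by
  ext x
  have hx : x = stdSimplex.vertex 0 := Subsingleton.elim _ _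
  subst hx
  change σ (stdSimplex.map _ _) = σ (stdSimplex.map _ _)
  rw [stdSimplex.map_vertex, stdSimplex.map_vertex]
  exact h.symm

theorem exists_homologyIncl_eq_pathClass (σ : C(stdSimplex ℝ (Fin 2), X))
    (h : σ (stdSimplex.vertex 0) = σ (stdSimplex.vertex 1)) :
    ∃ z, homologyIncl X z = pathClass σ :=
  exists_homologyIncl_eq (by rw [fromOpcycles_pathClass, comp_faceMap_zero_eq σ h, sub_self])

theorem fromOpcycles_homologyIncl (z : RatH1 X) :
    ((ratChains X).fromOpcycles 1 0).hom (homologyIncl X z) = 0 :=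
  congrArg (fun m => ModuleCat.Hom.hom m z) ((ratChains X).homologyι_comp_fromOpcycles 1 0)

/-- A linear map whose value on each path is the difference of a function at the end points
vanishes on the homology. -/
theorem homologyIncl_eq_zero_of_potential {T : Type} [AddCommGroup T] [Module ℚ T]
    (φ : OneChains X →ₗ[ℚ] T) (Γ : X → T)
    (h : ∀ σ, φ (pathClass σ) = Γ (σ (stdSimplex.vertex 1)) - Γ (σ (stdSimplex.vertex 0)))
    (z : RatH1 X) : φ (homologyIncl X z) = 0 := by
  -- Such a functional is the 0-cochain `Γ` composed with the boundary map, and the boundary map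
  -- kills homology classes.
  have h1 : φ = chainsDesc (n := 0) (fun σ : C(stdSimplex ℝ (Fin 1), X) =>
      Γ (σ (stdSimplex.vertex 0))) ∘ₗ ((ratChains X).fromOpcycles 1 0).hom := by
    refine oneChains_hom_ext fun σ => ?_
    rw [LinearMap.comp_apply, fromOpcycles_pathClass, map_sub, chainsDesc_simplexChain,
      chainsDesc_simplexChain, h]
    change _ = Γ (σ (stdSimplex.map _ _)) - Γ (σ (stdSimplex.map _ _))
    rw [stdSimplex.map_vertex, stdSimplex.map_vertex]
    rfl
  rw [h1, LinearMap.comp_apply, fromOpcycles_homologyIncl, map_zero]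

end SingularChains

/-! ### Affine paths -/

section AffinePaths

variable {X Y : Type} [TopologicalSpace X] [TopologicalSpace Y]
variable {V : Type} [AddCommGroup V] [Module ℝ V] [TopologicalSpace V] [ContinuousAdd V]
  [ContinuousSMul ℝ V]

/-- The affine simplex with given vertices. -/
def affineSimplex {n : ℕ} (v : Fin (n + 1) → V) : C(stdSimplex ℝ (Fin (n + 1)), V) where
  toFun x := ∑ i, x i • v i
  continuous_toFun := by
    refine continuous_finsetSum _ fun i _ => Continuous.smul ?_ continuous_const
    exact (continuous_apply i).comp continuous_subtype_val

theorem affineSimplex_apply {n : ℕ} (v : Fin (n + 1) → V) (x : stdSimplex ℝ (Fin (n + 1))) :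
    affineSimplex v x = ∑ i, x i • v i := rfl

theorem affineSimplex_comp_faceMap {n : ℕ} (v : Fin (n + 2) → V) (i : Fin (n + 2)) :
    (affineSimplex v).comp (faceMap n i) = affineSimplex (v ∘ i.succAbove) := by
  ext x
  simp only [ContinuousMap.comp_apply, affineSimplex_apply]
  have h1 : ∀ k, (faceMap n i x) k = ∑ j with i.succAbove j = k, x j := fun k => by
    change stdSimplex.map i.succAbove x k = _
    rw [stdSimplex.map_coe]
    simp [FunOnFinite.linearMap_apply_apply]
  simp only [h1, Finset.sum_smul, Function.comp]
  rw [Finset.sum_sigma']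
  refine Finset.sum_bij' (fun p _ => p.2) (fun j _ => ⟨i.succAbove j, j⟩) ?_ ?_ ?_ ?_ ?_ <;>
    simp +contextual

theorem affineSimplex_vertex {n : ℕ} (v : Fin (n + 1) → V) (i : Fin (n + 1)) :
    affineSimplex v (stdSimplex.vertex i) = v i := by
  simp [affineSimplex_apply, Pi.single_apply]

/-- The class of the path `g ∘ [a, b]`. -/
def segClass (g : C(V, X)) (a b : V) : OneChains X := pathClass (g.comp (affineSimplex ![a, b]))

/-- Since `g` is defined on the whole vector space, the affine triangle on `a`, `b`, `c` is a
singular 2-simplex; no homotopy or reparametrization is required. -/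
theorem segClass_add (g : C(V, X)) (a b c : V) :
    segClass g a b + segClass g b c = segClass g a c := by
  have h := pathClass_triangle (g.comp (affineSimplex ![a, b, c]))
  simp only [ContinuousMap.comp_assoc, affineSimplex_comp_faceMap] at h
  have e0 : ![a, b, c] ∘ (0 : Fin 3).succAbove = ![b, c] := by ext i; fin_cases i <;> rfl
  have e1 : ![a, b, c] ∘ (1 : Fin 3).succAbove = ![a, c] := by ext i; fin_cases i <;> rfl
  have e2 : ![a, b, c] ∘ (2 : Fin 3).succAbove = ![a, b] := by ext i; fin_cases i <;> rfl
  rw [e0, e1, e2] at h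
  exact h.symm

theorem segClass_self (g : C(V, X)) (a : V) : segClass g a a = 0 := by
  simpa using segClass_add g a a a

theorem segClass_congr {W : Type} [AddCommGroup W] [Module ℝ W] [TopologicalSpace W]
    [ContinuousAdd W] [ContinuousSMul ℝ W] (g : C(V, X)) (h : C(W, X)) (a b : V) (c d : W)
    (H : ∀ s t : ℝ, 0 ≤ s → 0 ≤ t → s + t = 1 → g (s • a + t • b) = h (s • c + t • d)) :
    segClass g a b = segClass h c d := by
  unfold segClass
  congr 1
  ext x
  simp only [ContinuousMap.comp_apply, affineSimplex_apply]
  change g (∑ i : Fin 2, _) = h (∑ i : Fin 2, _)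
  rw [Fin.sum_univ_two, Fin.sum_univ_two]
  exact H _ _ (stdSimplex.zero_le x 0) (stdSimplex.zero_le x 1) (by
    have := stdSimplex.sum_eq_one x
    rwa [Fin.sum_univ_two] at this)

theorem segClass_eq_zero (g : C(V, X)) (a b : V)
    (H : ∀ s t : ℝ, 0 ≤ s → 0 ≤ t → s + t = 1 → g (s • a + t • b) = g a) :
    segClass g a b = 0 := by
  rw [← segClass_self g a]
  refine segClass_congr _ _ _ _ _ _ fun s t hs ht hst => ?_
  rw [H s t hs ht hst, ← add_smul, hst, one_smul]

theorem oneChainsMap_segClass (f : C(X, Y)) (g : C(V, X)) (a b : V) :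
    oneChainsMap f (segClass g a b) = segClass (f.comp g) a b :=
  oneChainsMap_pathClass f _

/-- The standard 1-simplex, parametrized by the line. -/
def simplexParam : C(ℝ, stdSimplex ℝ (Fin 2)) :=
  ⟨fun t => stdSimplexHomeomorphUnitInterval.symm (Set.projIcc 0 1 zero_le_one t), by fun_prop⟩

theorem simplexParam_apply_one (x : stdSimplex ℝ (Fin 2)) : simplexParam (x 1) = x := by
  change stdSimplexHomeomorphUnitInterval.symm _ = x
  rw [Homeomorph.symm_apply_eq]
  exact Set.projIcc_of_mem _ (stdSimplexHomeomorphUnitInterval x).2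

theorem simplexParam_zero : simplexParam 0 = stdSimplex.vertex 0 := by
  rw [← simplexParam_apply_one (stdSimplex.vertex 0)]
  congr 1

theorem simplexParam_one : simplexParam 1 = stdSimplex.vertex 1 := by
  rw [← simplexParam_apply_one (stdSimplex.vertex 1)]
  congr 1

/-- Every singular 1-simplex is the restriction to `[0, 1]` of a path `ℝ → X`. -/
theorem pathClass_eq_segClass (σ : C(stdSimplex ℝ (Fin 2), X)) :
    pathClass σ = segClass (σ.comp simplexParam) 0 1 := by
  unfold segClass
  congr 1
  ext x
  simp only [ContinuousMap.comp_apply, affineSimplex_apply]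
  change σ x = σ (simplexParam (∑ i : Fin 2, x i • ![(0 : ℝ), 1] i))
  rw [Fin.sum_univ_two]
  simp [simplexParam_apply_one]

theorem exists_homologyIncl_eq_segClass (g : C(V, X)) (a b : V) (h : g a = g b) :
    ∃ z, homologyIncl X z = segClass g a b :=
  exists_homologyIncl_eq_pathClass _ (by
    simp only [ContinuousMap.comp_apply, affineSimplex_vertex]
    exact h)

end AffinePaths

/-! ### Lifts to the line and winding numbers -/

section Winding

variable {A : Type*} [TopologicalSpace A]

theorem exists_real_lift [SimplyConnectedSpace A] [LocallyPathConnectedSpace A]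
    (p : C(A, UnitAddCircle)) : ∃ F : C(A, ℝ), ∀ a, (F a : UnitAddCircle) = p a := by
  obtain ⟨a₀⟩ : Nonempty A := inferInstance
  obtain ⟨e₀, he⟩ := QuotientAddGroup.mk_surjective (p a₀)
  obtain ⟨F, ⟨-, hF⟩, -⟩ := (AddCircle.isCoveringMap_coe (1 : ℝ)).existsUnique_continuousMap_lifts
    p a₀ e₀ he
  exact ⟨F, fun a => congrFun hF a⟩

theorem real_lift_sub_eq [PreconnectedSpace A] {F G : A → ℝ} (hF : Continuous F)
    (hG : Continuous G) (h : ∀ a, (F a : UnitAddCircle) = G a) (a b : A) :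
    F b - F a = G b - G a := by
  have h1 : F = fun x => G x + (F a - G a) := by
    refine (AddCircle.isCoveringMap_coe (1 : ℝ)).eq_of_comp_eq hF (by fun_prop) ?_ a (by ring)
    ext x
    simp [h x, h a]
  have := congrFun h1 b
  change F b = _ at this
  linarith

/-- The total increase over `[0, 1]` of a lift of a path on the circle. -/
def pathWinding (p : C(ℝ, UnitAddCircle)) : ℝ :=
  (exists_real_lift p).choose 1 - (exists_real_lift p).choose 0

theorem pathWinding_eq {p : C(ℝ, UnitAddCircle)} {F : ℝ → ℝ} (hF : Continuous F)
    (h : ∀ t, (F t : UnitAddCircle) = p t) : pathWinding p = F 1 - F 0 :=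
  real_lift_sub_eq (exists_real_lift p).choose.continuous hF
    (fun t => ((exists_real_lift p).choose_spec t).trans (h t).symm) 0 1

/-- The square, retracted from the plane, folded onto the standard 2-simplex. -/
def triangleParam : C(ℝ × ℝ, stdSimplex ℝ (Fin 3)) where
  toFun x := ⟨![1 - (Set.projIcc (0 : ℝ) 1 zero_le_one x.1 : ℝ),
      (Set.projIcc (0 : ℝ) 1 zero_le_one x.1 : ℝ) *
        (1 - (Set.projIcc (0 : ℝ) 1 zero_le_one x.2 : ℝ)),
      (Set.projIcc (0 : ℝ) 1 zero_le_one x.1 : ℝ) * Set.projIcc (0 : ℝ) 1 zero_le_one x.2], by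
    have h1 := (Set.projIcc (0 : ℝ) 1 zero_le_one x.1).2
    have h2 := (Set.projIcc (0 : ℝ) 1 zero_le_one x.2).2
    refine ⟨fun i => ?_, ?_⟩
    · fin_cases i
      · exact sub_nonneg.2 h1.2
      · exact mul_nonneg h1.1 (sub_nonneg.2 h2.2)
      · exact mul_nonneg h1.1 h2.1
    · simp [Fin.sum_univ_three]
      ring⟩
  continuous_toFun := by
    refine Continuous.subtype_mk (continuous_pi fun i => ?_) _
    fin_cases i <;> simp <;> fun_prop

/-- Pulled back to the plane by `triangleParam`, the simplex has one real lift. Three sides of the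
unit square trace the three faces, and the fourth side collapses to a vertex, so that the lift is
constant on it; the increments then add up. -/
theorem pathWinding_triangle (τ : C(stdSimplex ℝ (Fin 3), UnitAddCircle)) :
    pathWinding ((τ.comp (faceMap 1 1)).comp simplexParam) =
      pathWinding ((τ.comp (faceMap 1 2)).comp simplexParam) +
        pathWinding ((τ.comp (faceMap 1 0)).comp simplexParam) := by
  obtain ⟨F, hF⟩ := exists_real_lift (τ.comp triangleParam)
  have e : ∀ t : ℝ, ∀ i : Fin 2, simplexParam t i =
      (![1 - (Set.projIcc (0 : ℝ) 1 zero_le_one t : ℝ), (Set.projIcc (0 : ℝ) 1 zero_le_one t : ℝ)]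
        : Fin 2 → ℝ) i := fun t i => rfl
  have key : ∀ (i : Fin 3) (u : ℝ → ℝ × ℝ) (_ : Continuous u)
      (_ : ∀ t, triangleParam (u t) = faceMap 1 i (simplexParam t)),
      pathWinding ((τ.comp (faceMap 1 i)).comp simplexParam) = F (u 1) - F (u 0) := by
    intro i u hu h
    refine pathWinding_eq (F := fun t => F (u t)) (by fun_prop) fun t => ?_
    rw [hF, ContinuousMap.comp_apply, h]
    rfl
  have face : ∀ (i k : Fin 3) (t : ℝ), faceMap 1 i (simplexParam t) k =
      (if i.succAbove 0 = k then simplexParam t 0 else 0) +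
        (if i.succAbove 1 = k then simplexParam t 1 else 0) := by
    intro i k t
    change stdSimplex.map i.succAbove (simplexParam t) k = _
    rw [stdSimplex.map_coe, FunOnFinite.linearMap_apply_apply, Finset.sum_filter]
    change ∑ j : Fin 2, _ = _
    rw [Fin.sum_univ_two]
  rw [key 0 (fun t => (1, t)) (by fun_prop) ?_, key 1 (fun t => (t, 1)) (by fun_prop) ?_,
    key 2 (fun t => (t, 0)) (by fun_prop) ?_]
  · have hc : F (0, 1) - F (0, 0) = (0 : ℝ) - 0 := by
      refine real_lift_sub_eq (A := ℝ) (F := fun t => F (0, t)) (G := fun _ => 0 + F (0, 0))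
        (by fun_prop) (by fun_prop) (fun t => ?_) 0 1 |>.trans (by ring)
      rw [zero_add, hF, hF, ContinuousMap.comp_apply, ContinuousMap.comp_apply]
      congr 1
      ext i
      fin_cases i <;> simp [triangleParam]
    linarith
  all_goals
    intro t
    ext i
    rw [face, e, e]
    fin_cases i <;> simp [triangleParam, Fin.succAbove] <;> rfl

end Winding

section WindingHom

variable {V : Type} [AddCommGroup V] [Module ℝ V] [TopologicalSpace V] [ContinuousAdd V]
  [ContinuousSMul ℝ V]

/-- The winding number as a linear functional on 1-chains of the circle modulo boundaries. -/
def windingHom : OneChains UnitAddCircle →ₗ[ℚ] ℝ :=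
  oneChainsDesc (fun σ => pathWinding (σ.comp simplexParam)) pathWinding_triangle

theorem windingHom_segClass {g : C(V, UnitAddCircle)} {F : V → ℝ} (hF : Continuous F)
    (h : ∀ v, (F v : UnitAddCircle) = g v) (a b : V) :
    windingHom (segClass g a b) = F b - F a := by
  unfold windingHom segClass
  rw [oneChainsDesc_pathClass, pathWinding_eq
    (F := fun t => F (affineSimplex ![a, b] (simplexParam t))) (by fun_prop) (fun t => by rw [h]; rfl)]
  rw [simplexParam_zero, simplexParam_one, affineSimplex_vertex, affineSimplex_vertex]
  rfl

end WindingHom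

/-! ### Wedges of circles -/

/-- A space is a wedge of the given loops if it is their union and the loops are simple and meet
only at their common base point. -/
structure IsWedge {ι X : Type} [TopologicalSpace X] (l : ι → C(UnitAddCircle, X)) : Prop where
  injective : ∀ i, Function.Injective (l i)
  base : ∀ i j, l i 0 = l j 0
  eq_zero : ∀ i j s t, i ≠ j → l i s = l j t → s = 0
  surjective : ∀ x, ∃ i s, l i s = x

namespace IsWedge

variable {ι X : Type} [TopologicalSpace X] {l : ι → C(UnitAddCircle, X)}

open Classical in
/-- The map to the circle which inverts the `i`-th loop and collapses the other ones. -/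
def collapseFun (l : ι → C(UnitAddCircle, X)) (i : ι) (x : X) : UnitAddCircle :=
  if h : ∃ s, l i s = x then h.choose else 0

theorem collapseFun_self (h : IsWedge l) (i : ι) (s : UnitAddCircle) :
    collapseFun l i (l i s) = s := by
  have hs : ∃ t, l i t = l i s := ⟨s, rfl⟩
  rw [collapseFun, dif_pos hs]
  exact h.injective i hs.choose_spec

theorem collapseFun_of_ne (h : IsWedge l) {i j : ι} (hij : i ≠ j) (s : UnitAddCircle) :
    collapseFun l i (l j s) = 0 := by
  rw [collapseFun]
  split_ifs with hs
  · exact h.eq_zero i j _ _ hij hs.choose_spec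
  · rfl

/-- The disjoint union of finitely many circles is compact and `X` is Hausdorff, so its map onto `X`
is a quotient map, and continuity can be tested on each circle. -/
theorem continuous_collapseFun [Finite ι] [T2Space X] (h : IsWedge l) (i : ι) :
    Continuous (collapseFun l i) := by
  let F : (Σ _ : ι, UnitAddCircle) → X := fun p => l p.1 p.2
  have hF : Continuous F := continuous_sigma fun j => (l j).continuous
  have hq : Topology.IsQuotientMap F := hF.isClosedMap.isQuotientMap hF fun x => by
    obtain ⟨j, s, hs⟩ := h.surjective x
    exact ⟨⟨j, s⟩, hs⟩
  rw [hq.continuous_iff]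
  refine continuous_sigma fun j => ?_
  by_cases hij : i = j
  · subst hij
    exact continuous_id.congr fun s => (h.collapseFun_self i s).symm
  · exact continuous_const.congr fun s => (h.collapseFun_of_ne hij s).symm

/-- The map to the circle which inverts the `i`-th loop and collapses the other ones. -/
def collapse [Finite ι] [T2Space X] (h : IsWedge l) (i : ι) : C(X, UnitAddCircle) :=
  ⟨collapseFun l i, h.continuous_collapseFun i⟩

section

variable [Finite ι] [T2Space X] (h : IsWedge l)

include h

theorem collapse_self (i : ι) (s : UnitAddCircle) : h.collapse i (l i s) = s :=
  h.collapseFun_self i s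

theorem collapse_of_ne {i j : ι} (hij : i ≠ j) (s : UnitAddCircle) : h.collapse i (l j s) = 0 :=
  h.collapseFun_of_ne hij s

theorem collapse_eq [DecidableEq ι] (i j : ι) (s : UnitAddCircle) :
    h.collapse i (l j s) = if i = j then s else 0 := by
  split_ifs with hij
  · subst hij
    exact h.collapse_self i s
  · exact h.collapse_of_ne hij s

/-- If the points lie on different circles, comparing the two coordinates puts both at the base
point. -/
theorem ext {x y : X} (hxy : ∀ i, h.collapse i x = h.collapse i y) : x = y := by
  obtain ⟨i, s, rfl⟩ := h.surjective x
  obtain ⟨j, t, rfl⟩ := h.surjective y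
  by_cases hij : i = j
  · subst hij
    have := hxy i
    rw [h.collapse_self, h.collapse_self] at this
    rw [this]
  · have h1 := hxy i
    have h2 := hxy j
    rw [h.collapse_self, h.collapse_of_ne hij] at h1
    rw [h.collapse_self, h.collapse_of_ne (Ne.symm hij)] at h2
    rw [h1, ← h2]
    exact h.base i j

omit [T2Space X] in
theorem compactSpace : CompactSpace X := by
  let F : (Σ _ : ι, UnitAddCircle) → X := fun p => l p.1 p.2
  have hF : Continuous F := continuous_sigma fun j => (l j).continuous
  have hs : Function.Surjective F := fun x => by
    obtain ⟨j, s, hs⟩ := h.surjective x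
    exact ⟨⟨j, s⟩, hs⟩
  exact ⟨by rw [← hs.range_eq]; exact isCompact_range hF⟩

theorem isClosedEmbedding_collapse :
    Topology.IsClosedEmbedding (fun x i => h.collapse i x) := by
  have := h.compactSpace
  exact Continuous.isClosedEmbedding (continuous_pi fun i => (h.collapse i).continuous)
    fun x y hxy => h.ext fun i => congrFun hxy i

/-- Continuous coordinates, at most one of which is not zero at each point, define a map to the
wedge. -/
theorem exists_map [Nonempty ι] {A : Type*} [TopologicalSpace A] {u : A → ι → ℝ}
    (hu : Continuous u) (hu1 : ∀ a i j, i ≠ j → u a i = 0 ∨ u a j = 0) :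
    ∃ g : C(A, X), ∀ a i, h.collapse i (g a) = (u a i : UnitAddCircle) := by
  have key : ∀ a, ∃ x, ∀ i, h.collapse i x = (u a i : UnitAddCircle) := by
    intro a
    obtain ⟨i, hi⟩ : ∃ i, ∀ j, i ≠ j → u a j = 0 := by
      by_cases h0 : ∃ i, u a i ≠ 0
      · obtain ⟨i, hi⟩ := h0
        exact ⟨i, fun j hij => (hu1 a i j hij).resolve_left hi⟩
      · push Not at h0
        exact ⟨Classical.arbitrary ι, fun j _ => h0 j⟩
    refine ⟨l i (u a i), fun j => ?_⟩
    by_cases hij : i = j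
    · subst hij
      exact h.collapse_self i _
    · rw [h.collapse_of_ne (Ne.symm hij), hi j hij]
      rfl
  choose g hg using key
  refine ⟨⟨g, ?_⟩, hg⟩
  rw [h.isClosedEmbedding_collapse.isEmbedding.continuous_iff]
  refine continuous_pi fun i => ?_
  have : Continuous fun a => (u a i : UnitAddCircle) :=
    continuous_quotient_mk'.comp ((continuous_apply i).comp hu)
  exact this.congr fun a => (hg a i).symm

/-- Every point has a neighbourhood with continuous real coordinates. -/
theorem exists_local_coordinates (x : X) : ∃ O ∈ nhds x, ∃ u : X → ι → ℝ, ContinuousOn u O ∧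
    (∀ y i j, i ≠ j → u y i = 0 ∨ u y j = 0) ∧
      ∀ y ∈ O, ∀ i, h.collapse i y = (u y i : UnitAddCircle) := by
  classical
  obtain ⟨i, s, rfl⟩ := h.surjective x
  by_cases hs : s = 0
  · subst hs
    -- At the base point every circle is cut opposite to it. The coordinate `0` then lifts to the
    -- real number `0`, so at most one lifted coordinate is nonzero.
    let a : ℝ := -(1 / 2)
    have ha : (a : UnitAddCircle) ≠ 0 := by
      intro h0
      obtain ⟨n, hn⟩ := (AddCircle.coe_eq_zero_iff (1 : ℝ)).1 h0
      have h2 : (n : ℝ) * 2 = -1 := by simp [a] at hn; linarith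
      have : n * 2 = -1 := by exact_mod_cast h2
      omega
    refine ⟨⋂ k, {y | h.collapse k y ≠ a}, ?_, fun y k => AddCircle.equivIco 1 a (h.collapse k y),
      ?_, ?_, ?_⟩
    · refine (isOpen_iInter_of_finite fun k => ?_).mem_nhds ?_
      · exact isOpen_compl_singleton.preimage (h.collapse k).continuous
      · simp only [Set.mem_iInter, Set.mem_ofPred_eq]
        intro k
        rw [h.collapse_eq]
        simpa using ha.symm
    · refine continuousOn_pi.2 fun k y hy => ContinuousAt.continuousWithinAt ?_
      exact continuous_subtype_val.continuousAt.comp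
        ((AddCircle.continuousAt_equivIco 1 a (Set.mem_iInter.1 hy k)).comp
          (h.collapse k).continuous.continuousAt)
    · intro y k m hkm
      obtain ⟨j, t, rfl⟩ := h.surjective y
      have h0 : ((AddCircle.equivIco 1 a 0 : Set.Ico a (a + 1)) : ℝ) = 0 := by
        have := AddCircle.equivIco_coe_eq (p := (1 : ℝ)) (a := a) (x := 0)
          (by constructor <;> norm_num [a])
        exact congrArg Subtype.val this
      beta_reduce
      by_cases hk : k = j
      · right
        rw [h.collapse_of_ne (by rintro rfl; exact hkm hk), h0]
      · left
        rw [h.collapse_of_ne hk, h0]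
    · intro y _ k
      exact (AddCircle.coe_equivIco (p := (1 : ℝ)) (a := a)).symm
  · refine ⟨{y | h.collapse i y ≠ 0}, ?_,
      fun y => Pi.single i (AddCircle.equivIco 1 0 (h.collapse i y) : ℝ), ?_, ?_, ?_⟩
    · refine (isOpen_compl_singleton.preimage (h.collapse i).continuous).mem_nhds ?_
      simpa [h.collapse_self] using hs
    · refine (continuous_single i).comp_continuousOn fun y hy =>
        ContinuousAt.continuousWithinAt ?_
      exact continuous_subtype_val.continuousAt.comp
        ((AddCircle.continuousAt_equivIco 1 0 hy).comp (h.collapse i).continuous.continuousAt)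
    · intro y k m hkm
      beta_reduce
      by_cases hk : k = i
      · right
        rw [Pi.single_eq_of_ne (by rintro rfl; exact hkm hk)]
      · left
        rw [Pi.single_eq_of_ne hk]
    · intro y hy k
      obtain ⟨j, t, rfl⟩ := h.surjective y
      have hij : i = j := by
        by_contra hij
        exact hy (h.collapse_of_ne hij t)
      subst hij
      beta_reduce
      by_cases hk : k = i
      · subst hk
        rw [Pi.single_eq_same]
        exact (AddCircle.coe_equivIco (p := (1 : ℝ)) (a := 0)).symm
      · rw [Pi.single_eq_of_ne hk, h.collapse_of_ne hk]
        rfl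

end

/-- The `i`-th loop as a periodic path. -/
def line (l : ι → C(UnitAddCircle, X)) (i : ι) : C(ℝ, X) :=
  (l i).comp ⟨fun t : ℝ => (t : UnitAddCircle), continuous_quotient_mk'⟩

theorem line_apply (i : ι) (t : ℝ) : line l i t = l i t := rfl

/-- The span of the classes of the loops. -/
def loopSpan (l : ι → C(UnitAddCircle, X)) : Submodule ℚ (OneChains X) :=
  Submodule.span ℚ (Set.range fun i => segClass (line l i) 0 1)

/-- A full turn vanishes in the quotient, so the class of the arc from `0` to `t` depends only on
`t` modulo `1`; this makes `loopPotential` well defined. -/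
theorem periodic_segClass (l : ι → C(UnitAddCircle, X)) (i : ι) :
    Function.Periodic (fun t : ℝ => (loopSpan l).mkQ (segClass (line l i) 0 t)) 1 := by
  intro t
  have h1 : (loopSpan l).mkQ (segClass (line l i) 0 1) = 0 := by
    rw [Submodule.mkQ_apply, Submodule.Quotient.mk_eq_zero]
    exact Submodule.subset_span ⟨i, rfl⟩
  have h2 : segClass (line l i) 1 (t + 1) = segClass (line l i) 0 t := by
    refine segClass_congr _ _ _ _ _ _ fun a b _ _ hab => ?_
    have : a • (1 : ℝ) + b • (t + 1) = (a • (0 : ℝ) + b • t) + 1 := by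
      simp only [smul_eq_mul]
      linear_combination hab
    rw [this, line_apply, line_apply, AddCircle.coe_add_period]
  change (loopSpan l).mkQ _ = (loopSpan l).mkQ _
  rw [← segClass_add (line l i) 0 1 (t + 1), map_add, h1, h2, zero_add]

/-- The class of the path along the `i`-th loop from the base point to a given point. -/
def loopPotential (l : ι → C(UnitAddCircle, X)) (i : ι) (s : UnitAddCircle) :
    OneChains X ⧸ loopSpan l :=
  (periodic_segClass l i).lift s

theorem loopPotential_coe (i : ι) (t : ℝ) :
    loopPotential l i t = (loopSpan l).mkQ (segClass (line l i) 0 t) := rfl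

theorem loopPotential_zero (i : ι) : loopPotential l i 0 = 0 := by
  have := loopPotential_coe (l := l) i 0
  rw [segClass_self, map_zero] at this
  exact this

section

variable [Fintype ι] [T2Space X] (h : IsWedge l)

/-- The class of a path from the base point to a given point, modulo the loops. -/
def potential (x : X) : OneChains X ⧸ loopSpan l := ∑ i, loopPotential l i (h.collapse i x)

include h

theorem mkQ_segClass_of_lift [Nonempty ι] (p : C(ℝ, X)) {u : ℝ → ι → ℝ} (hu : Continuous u)
    (hu1 : ∀ a i j, i ≠ j → u a i = 0 ∨ u a j = 0)
    (hup : ∀ t i, h.collapse i (p t) = (u t i : UnitAddCircle)) (a b : ℝ) :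
    (loopSpan l).mkQ (segClass p a b) = h.potential (p b) - h.potential (p a) := by
  classical
  -- The path is contracted to the base point by scaling its real coordinates. In the resulting
  -- square one side is constant, the opposite one is `p`, and the other two are arcs from the base
  -- point to `p a` and `p b`.
  obtain ⟨g, hg⟩ := h.exists_map (A := ℝ × ℝ) (u := fun x => x.1 • u x.2) (by fun_prop)
    (fun x i j hij => by
      rcases hu1 x.2 i j hij with h0 | h0
      · left; simp [h0]
      · right; simp [h0])
  have ray : ∀ c, (loopSpan l).mkQ (segClass g (0, c) (1, c)) = h.potential (p c) := by
    intro c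
    obtain ⟨i, hi⟩ : ∃ i, ∀ j, i ≠ j → u c j = 0 := by
      by_cases h0 : ∃ i, u c i ≠ 0
      · obtain ⟨i, hi⟩ := h0
        exact ⟨i, fun j hij => (hu1 c i j hij).resolve_left hi⟩
      · push Not at h0
        exact ⟨Classical.arbitrary ι, fun j _ => h0 j⟩
    rw [potential, Finset.sum_eq_single i, hup, loopPotential_coe]
    · congr 1
      refine segClass_congr _ _ _ _ _ _ fun x y hx hy hxy => ?_
      refine h.ext fun j => ?_
      have e : x • ((0, c) : ℝ × ℝ) + y • ((1, c) : ℝ × ℝ) = (y, c) := by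
        ext
        · simp
        · simp only [Prod.snd_add, Prod.smul_snd, smul_eq_mul]
          linear_combination c * hxy
      rw [e, hg, line_apply, h.collapse_eq]
      split_ifs with hij
      · subst hij
        simp
      · simp [hi j (Ne.symm hij)]
    · intro j _ hj
      rw [hup, hi j (Ne.symm hj)]
      exact loopPotential_zero j
    · simp
  have h1 : segClass g (0, a) (0, b) = 0 := by
    refine segClass_eq_zero _ _ _ fun x y hx hy hxy => h.ext fun j => ?_
    rw [hg, hg]
    simp
  have h2 : segClass g (1, a) (1, b) = segClass p a b := by
    refine segClass_congr _ _ _ _ _ _ fun x y hx hy hxy => h.ext fun j => ?_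
    have e : x • ((1, a) : ℝ × ℝ) + y • ((1, b) : ℝ × ℝ) = (1, x • a + y • b) := by
      ext <;> simp [hxy]
    rw [e, hg, hup]
    simp
  have h3 : segClass g (0, a) (1, a) + segClass p a b =
      segClass g (0, b) (1, b) := by
    rw [← h2, segClass_add, ← segClass_add g (0, a) (0, b) (1, b), h1, zero_add]
  rw [← ray, ← ray, ← h3, map_add]
  abel

/-- Local coordinates give the formula for nearby parameters. By additivity of `segClass` the set of
end points for which it holds is then open and closed in the line, hence everything. -/
theorem mkQ_segClass [Nonempty ι] (p : C(ℝ, X)) (a b : ℝ) :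
    (loopSpan l).mkQ (segClass p a b) = h.potential (p b) - h.potential (p a) := by
  have loc : ∀ t, ∀ᶠ s in nhds t,
      (loopSpan l).mkQ (segClass p t s) = h.potential (p s) - h.potential (p t) := by
    intro t
    obtain ⟨O, hO, u, hu, hu1, hup⟩ := h.exists_local_coordinates (p t)
    obtain ⟨ε, hε, hball⟩ := Metric.mem_nhds_iff.1 (p.continuous.continuousAt.preimage_mem_nhds hO)
    filter_upwards [Metric.ball_mem_nhds t hε] with s hs
    -- Clamping the parameter keeps the entire path inside the coordinate neighbourhood without
    -- changing it between `t` and `s`.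
    let c : C(ℝ, ℝ) := ⟨fun r => Set.projIcc (min t s) (max t s) min_le_max r, by fun_prop⟩
    have hc : ∀ r, p (c r) ∈ O := fun r => by
      refine hball ?_
      have h1 : (c r) ∈ Set.uIcc t s := (Set.projIcc (min t s) (max t s) min_le_max r).2
      exact (convex_ball t ε).ordConnected.uIcc_subset (Metric.mem_ball_self hε) hs h1
    have hcs : ∀ r ∈ Set.uIcc t s, c r = r := fun r hr => by
      change ((Set.projIcc (min t s) (max t s) min_le_max r : Set.Icc _ _) : ℝ) = r
      rw [Set.projIcc_of_mem _ hr]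
    have h2 : segClass p t s = segClass (p.comp c) t s := by
      refine segClass_congr _ _ _ _ _ _ fun x y hx hy hxy => ?_
      rw [ContinuousMap.comp_apply, hcs]
      exact (convex_uIcc t s) Set.left_mem_uIcc Set.right_mem_uIcc hx hy hxy
    have h3 := h.mkQ_segClass_of_lift (p.comp c) (u := fun r => u (p (c r)))
      (hu.comp_continuous (by fun_prop) hc) (fun r => hu1 _) (fun r i => hup _ (hc r) i) t s
    rw [h2, h3, ContinuousMap.comp_apply, ContinuousMap.comp_apply, hcs _ Set.left_mem_uIcc,
      hcs _ Set.right_mem_uIcc]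
  let S : Set ℝ := {t | (loopSpan l).mkQ (segClass p a t) = h.potential (p t) - h.potential (p a)}
  have hS : ∀ t, ∀ᶠ s in nhds t, s ∈ S ↔ t ∈ S := fun t => by
    filter_upwards [loc t] with s hs
    simp only [S, Set.mem_ofPred_eq]
    rw [← segClass_add p a t s, map_add, hs]
    constructor
    · intro h1
      rw [← sub_eq_zero] at h1 ⊢
      rw [← h1]
      abel
    · intro h1
      rw [h1]
      abel
  have hclopen : IsClopen S := by
    refine ⟨⟨isOpen_iff_mem_nhds.2 fun t ht => ?_⟩, isOpen_iff_mem_nhds.2 fun t ht => ?_⟩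
    · filter_upwards [hS t] with s hs
      exact fun hs1 => ht (hs.1 hs1)
    · filter_upwards [hS t] with s hs
      exact hs.2 ht
  have huniv : S = Set.univ := hclopen.eq_univ ⟨a, by simp [S, segClass_self]⟩
  have hb : b ∈ S := huniv ▸ Set.mem_univ b
  exact hb

theorem homologyIncl_mem_loopSpan [Nonempty ι] (z : RatH1 X) : homologyIncl X z ∈ loopSpan l := by
  rw [← Submodule.Quotient.mk_eq_zero, ← Submodule.mkQ_apply]
  refine homologyIncl_eq_zero_of_potential (loopSpan l).mkQ h.potential (fun σ => ?_) z
  rw [pathClass_eq_segClass, h.mkQ_segClass, ContinuousMap.comp_apply, ContinuousMap.comp_apply,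
    simplexParam_zero, simplexParam_one]

end

end IsWedge

/-! ### The first homology of a wedge of circles -/

theorem RatH1.map_comp {X Y Z : Type} [TopologicalSpace X] [TopologicalSpace Y]
    [TopologicalSpace Z] (g : C(Y, Z)) (f : C(X, Y)) :
    RatH1.map (g.comp f) = RatH1.map g ∘ₗ RatH1.map f := by
  refine LinearMap.ext fun z => homologyIncl_injective ?_
  rw [LinearMap.comp_apply, homologyIncl_map, homologyIncl_map, homologyIncl_map]
  refine LinearMap.congr_fun (f := oneChainsMap (g.comp f))
    (g := oneChainsMap g ∘ₗ oneChainsMap f) (oneChains_hom_ext fun σ => ?_) _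
  rw [LinearMap.comp_apply, oneChainsMap_pathClass, oneChainsMap_pathClass, oneChainsMap_pathClass]
  rfl

/-- The iterates of a continuous map, as continuous maps. -/
def iterateMap {X : Type} [TopologicalSpace X] (f : C(X, X)) (k : ℕ) : C(X, X) :=
  ⟨f^[k], f.continuous.iterate k⟩

theorem RatH1.map_iterateMap {X : Type} [TopologicalSpace X] (f : C(X, X)) (k : ℕ) :
    RatH1.map (iterateMap f k) = RatH1.map f ^ k := by
  induction k with
  | zero =>
    refine LinearMap.ext fun z => homologyIncl_injective ?_
    rw [homologyIncl_map, pow_zero, Module.End.one_apply]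
    suffices oneChainsMap (iterateMap f 0) = LinearMap.id by rw [this]; rfl
    exact oneChains_hom_ext fun σ => oneChainsMap_pathClass _ _
  | succ k ih =>
    rw [pow_succ, ← ih, Module.End.mul_eq_comp, ← RatH1.map_comp]
    rfl

/-- The identity presents the circle as a wedge of one circle. -/
theorem isWedge_circle : IsWedge fun _ : Unit => ContinuousMap.id UnitAddCircle where
  injective _ := Function.injective_id
  base _ _ := rfl
  eq_zero _ _ _ _ h := absurd rfl h
  surjective x := ⟨(), x, rfl⟩

theorem line_circle_apply (t : ℝ) :
    IsWedge.line (fun _ : Unit => ContinuousMap.id UnitAddCircle) () t = t := rfl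

/-- The circle is a wedge of one loop. The factor `q` records that `ω` is an arbitrary nonzero
class; it cancels from all matrix entries. -/
theorem homologyIncl_circle {ω : RatH1 UnitAddCircle} (hω : ω ≠ 0) : ∃ q : ℚ, q ≠ 0 ∧
    homologyIncl _ ω =
      q • segClass (IsWedge.line (fun _ : Unit => ContinuousMap.id UnitAddCircle) ()) 0 1 := by
  have h := isWedge_circle.homologyIncl_mem_loopSpan ω
  rw [IsWedge.loopSpan, Set.range_unique, Submodule.mem_span_singleton] at h
  obtain ⟨q, hq⟩ := h
  refine ⟨q, ?_, hq.symm⟩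
  rintro rfl
  rw [zero_smul] at hq
  exact hω (homologyIncl_injective (by rw [← hq, map_zero]))

theorem exists_circle_class_ne_zero : ∃ ω : RatH1 UnitAddCircle, ω ≠ 0 := by
  obtain ⟨z, hz⟩ := exists_homologyIncl_eq_segClass
    (IsWedge.line (fun _ : Unit => ContinuousMap.id UnitAddCircle) ()) 0 1 (by
      rw [line_circle_apply, line_circle_apply]
      simpa using (AddCircle.coe_period (1 : ℝ)).symm)
  refine ⟨z, ?_⟩
  rintro rfl
  have h := windingHom_segClass (F := fun t : ℝ => t) continuous_id
    (g := IsWedge.line (fun _ : Unit => ContinuousMap.id UnitAddCircle) ())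
    (fun t => (line_circle_apply t).symm) 0 1
  rw [← hz, map_zero, map_zero] at h
  norm_num at h

namespace IsWedge

variable {ι X : Type} [TopologicalSpace X] {l : ι → C(UnitAddCircle, X)}
variable [Fintype ι] [T2Space X] (h : IsWedge l)

omit [Fintype ι] [T2Space X] in
theorem homologyIncl_loop {ω : RatH1 UnitAddCircle} {q : ℚ} (hq : homologyIncl _ ω =
      q • segClass (IsWedge.line (fun _ : Unit => ContinuousMap.id UnitAddCircle) ()) 0 1) (i : ι) :
    homologyIncl X (RatH1.map (l i) ω) = q • segClass (line l i) 0 1 := by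
  rw [homologyIncl_map, hq, map_smul, oneChainsMap_segClass]
  rfl

/-- The winding number around the `i`-th circle. -/
def degree (i : ι) : RatH1 X →ₗ[ℚ] ℝ :=
  windingHom ∘ₗ oneChainsMap (h.collapse i) ∘ₗ homologyIncl X

include h

theorem windingHom_collapse_line [DecidableEq ι] (i j : ι) :
    windingHom (oneChainsMap (h.collapse i) (segClass (line l j) 0 1)) = if i = j then 1 else 0 := by
  rw [oneChainsMap_segClass, windingHom_segClass (F := fun t : ℝ => if i = j then t else 0)]
  · split_ifs <;> norm_num
  · split_ifs <;> fun_prop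
  · intro t
    rw [ContinuousMap.comp_apply, line_apply, h.collapse_eq]
    split_ifs <;> rfl

theorem degree_loop [DecidableEq ι] {ω : RatH1 UnitAddCircle} {q : ℚ} (hq : homologyIncl _ ω =
      q • segClass (IsWedge.line (fun _ : Unit => ContinuousMap.id UnitAddCircle) ()) 0 1)
    (i j : ι) : h.degree i (RatH1.map (l j) ω) = if i = j then (q : ℝ) else 0 := by
  rw [degree, LinearMap.comp_apply, LinearMap.comp_apply, homologyIncl_loop hq, map_smul, map_smul,
    h.windingHom_collapse_line]
  split_ifs
  · rw [Rat.smul_one_eq_cast]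
  · rw [smul_zero]

/-- The classes of the loops form a basis of the first homology. -/
theorem exists_basis [Nonempty ι] {ω : RatH1 UnitAddCircle} (hω : ω ≠ 0) :
    ∃ a : Module.Basis ι ℚ (RatH1 X), ∀ i, a i = RatH1.map (l i) ω := by
  classical
  obtain ⟨q, hq0, hq⟩ := homologyIncl_circle hω
  have hli : LinearIndependent ℚ fun i => RatH1.map (l i) ω := by
    rw [Fintype.linearIndependent_iff]
    intro c hc i
    have h1 := congrArg (h.degree i) hc
    rw [map_sum, map_zero] at h1
    simp only [map_smul, h.degree_loop hq] at h1
    simp only [smul_ite, smul_zero, Finset.sum_ite_eq, Finset.mem_univ, if_true] at h1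
    rw [Rat.smul_def] at h1
    have : (c i : ℝ) = 0 := (mul_eq_zero.1 h1).resolve_right (by exact_mod_cast hq0)
    exact_mod_cast this
  have hsp : ⊤ ≤ Submodule.span ℚ (Set.range fun i => RatH1.map (l i) ω) := by
    intro z _
    have hz := h.homologyIncl_mem_loopSpan z
    rw [loopSpan, Submodule.mem_span_range_iff_exists_fun] at hz
    obtain ⟨c, hc⟩ := hz
    rw [Submodule.mem_span_range_iff_exists_fun]
    refine ⟨fun i => c i * q⁻¹, homologyIncl_injective ?_⟩
    rw [map_sum, ← hc]
    refine Finset.sum_congr rfl fun i _ => ?_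
    rw [map_smul, homologyIncl_loop hq, smul_smul, inv_mul_cancel_right₀ hq0]
  exact ⟨Module.Basis.mk hli hsp, fun i => Module.Basis.mk_apply hli hsp i⟩

/-- The matrix entries of the induced map are winding numbers. -/
theorem toMatrix_apply [DecidableEq ι] [Nonempty ι] {ω : RatH1 UnitAddCircle} (hω : ω ≠ 0)
    {a : Module.Basis ι ℚ (RatH1 X)} (ha : ∀ i, a i = RatH1.map (l i) ω) (f : C(X, X)) (i j : ι) :
    (LinearMap.toMatrix a a (RatH1.map f) i j : ℝ) =
      pathWinding (((h.collapse i).comp f).comp (line l j)) := by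
  obtain ⟨q, hq0, hq⟩ := homologyIncl_circle hω
  have h1 : h.degree i (RatH1.map f (a j)) =
      q * LinearMap.toMatrix a a (RatH1.map f) i j := by
    conv_lhs => rw [← a.sum_repr (RatH1.map f (a j)), map_sum]
    simp only [map_smul, ha, h.degree_loop hq]
    rw [LinearMap.toMatrix_apply]
    simp only [smul_ite, smul_zero, Finset.sum_ite_eq, Finset.mem_univ, if_true]
    rw [Rat.smul_def, mul_comm, ha]
  have h2 : h.degree i (RatH1.map f (a j)) =
      q * pathWinding (((h.collapse i).comp f).comp (line l j)) := by
    rw [ha, degree, LinearMap.comp_apply, LinearMap.comp_apply, homologyIncl_map,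
      homologyIncl_loop hq, map_smul, map_smul, map_smul, oneChainsMap_segClass,
      oneChainsMap_segClass, Rat.smul_def]
    congr 1
    obtain ⟨F, hF⟩ := exists_real_lift (((h.collapse i).comp f).comp (line l j))
    rw [pathWinding_eq F.continuous hF]
    exact windingHom_segClass F.continuous hF 0 1
  have hq0' : (q : ℝ) ≠ 0 := by exact_mod_cast hq0
  exact mul_left_cancel₀ hq0' (h1.symm.trans h2)

end IsWedge

/-! ### Maps of a wedge which respect or reverse the orientation -/

theorem monotone_of_eventually_le {F : ℝ → ℝ} (hF : Continuous F)
    (h : ∀ t, ∀ᶠ s in nhdsWithin t (Set.Ioi t), F t ≤ F s) : Monotone F := by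
  intro a b hab
  have key : Set.Icc a b ⊆ {t | F a ≤ F t} := by
    refine IsClosed.Icc_subset_of_forall_exists_gt
      ((isClosed_le continuous_const hF).inter isClosed_Icc) (le_refl (F a)) ?_
    rintro x ⟨hx, -⟩ y hy
    have h1 : ∀ᶠ s in nhdsWithin x (Set.Ioi x), s ∈ Set.Ioc x y :=
      Ioc_mem_nhdsGT hy
    obtain ⟨s, hs, hs1⟩ := ((h x).and h1).exists
    exact ⟨s, le_trans hx hs, hs1⟩
  exact key ⟨hab, le_rfl⟩

theorem exists_int_of_circle_eq {x y : ℝ} (h : (x : UnitAddCircle) = y) : ∃ k : ℤ, x - y = k := by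
  have h1 : ((x - y : ℝ) : UnitAddCircle) = 0 := by
    rw [AddCircle.coe_sub, h, sub_self]
  obtain ⟨k, hk⟩ := (AddCircle.coe_eq_zero_iff (1 : ℝ)).1 h1
  exact ⟨k, by simpa using hk.symm⟩

theorem eq_of_circle_eq {x y : ℝ} (h : (x : UnitAddCircle) = y) (hxy : |x - y| < 1) : x = y := by
  obtain ⟨k, hk⟩ := exists_int_of_circle_eq h
  rw [hk] at hxy
  have h1 : |k| < 1 := by exact_mod_cast hxy
  rw [Int.abs_lt_one_iff] at h1
  rw [h1, Int.cast_zero] at hk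
  linarith

theorem circle_dist_le (x y : ℝ) : dist (x : UnitAddCircle) y ≤ |x - y| := by
  rw [dist_eq_norm, ← AddCircle.coe_sub, UnitAddCircle.norm_eq]
  simpa using round_le (x - y) 0

theorem circle_dist_eq {x y : ℝ} (h : |x - y| ≤ 1 / 2) :
    dist (x : UnitAddCircle) y = |x - y| := by
  rw [dist_eq_norm, ← AddCircle.coe_sub, AddCircle.norm_coe_eq_abs_iff (1 : ℝ) one_ne_zero]
  simpa using h

namespace IsWedge

variable {ι X : Type} [TopologicalSpace X] {l : ι → C(UnitAddCircle, X)}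
variable [Fintype ι] [T2Space X] (h : IsWedge l)

/-- `y` is obtained from `x` by a move in the direction `ε` by at most `δ` in each coordinate. -/
def Moves (ε δ : ℝ) (x y : X) : Prop :=
  ∀ i, ∃ c : ℝ, 0 ≤ c ∧ c ≤ δ ∧ h.collapse i y = h.collapse i x + ((ε * c : ℝ) : UnitAddCircle)

/-- A self-map takes small forward moves to small moves in the direction `ε`. -/
def LocallyDirected (ε : ℝ) (f : X → X) : Prop :=
  ∀ η > 0, ∃ δ > 0, ∀ x y, h.Moves 1 δ x y → h.Moves ε η (f x) (f y)

variable {h}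

theorem Moves.trans {ε δ δ' : ℝ} {x y z : X} (h1 : h.Moves ε δ x y) (h2 : h.Moves ε δ' y z) :
    h.Moves ε (δ + δ') x z := by
  intro i
  obtain ⟨c, hc0, hc, e⟩ := h1 i
  obtain ⟨c', hc0', hc', e'⟩ := h2 i
  exact ⟨c + c', by positivity, by linarith, by rw [e', e, mul_add, AddCircle.coe_add, add_assoc]⟩

theorem Moves.symm {ε δ : ℝ} {x y : X} (h1 : h.Moves ε δ x y) : h.Moves (-ε) δ y x := by
  intro i
  obtain ⟨c, hc0, hc, e⟩ := h1 i
  exact ⟨c, hc0, hc, by rw [e, neg_mul, AddCircle.coe_neg, add_neg_cancel_right]⟩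

/-- If `g` reverses direction, `f` is applied to the move read backwards. No derivatives enter, so
orbits through the base point cause no difficulty. -/
theorem LocallyDirected.comp {ε ε' : ℝ} (hε' : ε' = 1 ∨ ε' = -1) {f g : X → X}
    (hf : h.LocallyDirected ε f) (hg : h.LocallyDirected ε' g) :
    h.LocallyDirected (ε * ε') (f ∘ g) := by
  intro η hη
  obtain ⟨δ, hδ, hf⟩ := hf η hη
  obtain ⟨δ', hδ', hg⟩ := hg δ hδ
  refine ⟨δ', hδ', fun x y hxy => ?_⟩
  have h1 := hg x y hxy
  rcases hε' with rfl | rfl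
  · rw [mul_one]
    exact hf _ _ h1
  · rw [mul_neg_one]
    have h2 := h1.symm
    rw [neg_neg] at h2
    exact (hf _ _ h2).symm

theorem LocallyDirected.iterate {ε : ℝ} (hε : ε = 1 ∨ ε = -1) {f : X → X}
    (hf : h.LocallyDirected ε f) (k : ℕ) : h.LocallyDirected (ε ^ k) f^[k] := by
  induction k with
  | zero =>
    intro η hη
    exact ⟨η, hη, fun x y hxy => by simpa using hxy⟩
  | succ k ih =>
    rw [pow_succ, Function.iterate_succ]
    exact ih.comp hε hf

variable (h)

theorem moves_line (j : ι) {t s : ℝ} (hts : t ≤ s) :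
    h.Moves 1 (s - t) (line l j t) (line l j s) := by
  classical
  intro i
  refine ⟨if i = j then s - t else 0, ?_, ?_, ?_⟩
  · split_ifs <;> linarith
  · split_ifs <;> linarith
  · rw [line_apply, line_apply, h.collapse_eq, h.collapse_eq]
    split_ifs
    · rw [← AddCircle.coe_add]
      congr 1
      ring
    · simp

variable {h}

/-- Both the increment of `F` and the move are at most `1 / 4` in size, so their congruence modulo
`1` is an equality and the local increment has the sign of `ε`. -/
theorem LocallyDirected.monotone_lift {ε : ℝ} (hε : ε = 1 ∨ ε = -1) {f : X → X}
    (hf : h.LocallyDirected ε f) {i j : ι} {F : ℝ → ℝ} (hF : Continuous F)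
    (hl : ∀ t, (F t : UnitAddCircle) = h.collapse i (f (line l j t))) :
    Monotone fun t => ε * F t := by
  refine monotone_of_eventually_le (by fun_prop) fun t => ?_
  obtain ⟨δ, hδ, H⟩ := hf (1 / 4) (by norm_num)
  have h1 : ∀ᶠ s in nhds t, |F s - F t| < 1 / 4 := by
    have := hF.continuousAt.eventually (Metric.ball_mem_nhds (F t) (by norm_num : (0 : ℝ) < 1 / 4))
    filter_upwards [this] with s hs
    simpa [Real.dist_eq] using hs
  have h2 : ∀ᶠ s in nhds t, s < t + δ := eventually_lt_nhds (by linarith)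
  filter_upwards [nhdsWithin_le_nhds h1, nhdsWithin_le_nhds h2, self_mem_nhdsWithin]
    with s hs1 hs2 hs3
  have hs3' : t < s := hs3
  have hm : h.Moves 1 δ (line l j t) (line l j s) := by
    intro k
    obtain ⟨c, hc0, hc, e⟩ := h.moves_line j hs3'.le k
    exact ⟨c, hc0, by linarith, e⟩
  obtain ⟨c, hc0, hc, e⟩ := H _ _ hm i
  rw [← hl, ← hl, ← AddCircle.coe_add] at e
  have hs4 := abs_lt.1 hs1
  have hF1 : F s = F t + ε * c := by
    refine eq_of_circle_eq e (abs_lt.2 ?_)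
    rcases hε with rfl | rfl <;> constructor <;> linarith
  rw [hF1]
  rcases hε with rfl | rfl <;> nlinarith

variable (h)

/-- A small forward move is made of two small moves along circles which do not cross the base
point. -/
theorem Moves.exists_split {δ : ℝ} (hδ : δ < 1 / 2) {x y : X} (hxy : h.Moves 1 δ x y) :
    ∃ z, (∃ i, ∃ s c : ℝ, 0 ≤ s ∧ 0 ≤ c ∧ c ≤ δ ∧ s + c ≤ 1 ∧ x = line l i s ∧
        z = line l i (s + c)) ∧
      ∃ i, ∃ s c : ℝ, 0 ≤ s ∧ 0 ≤ c ∧ c ≤ δ ∧ s + c ≤ 1 ∧ z = line l i s ∧ y = line l i (s + c) := by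
  have rep : ∀ s : UnitAddCircle, ∃ r : ℝ, 0 ≤ r ∧ r < 1 ∧ (r : UnitAddCircle) = s := fun s => by
    refine ⟨AddCircle.equivIco 1 0 s, (AddCircle.equivIco 1 0 s).2.1, ?_, AddCircle.coe_equivIco⟩
    simpa using (AddCircle.equivIco 1 0 s).2.2
  have hone : ∀ i, line l i 1 = line l i 0 := fun i => by
    rw [line_apply, line_apply, AddCircle.coe_period, AddCircle.coe_zero]
  have hbase : ∀ i j, line l i 0 = line l j 0 := fun i j => by
    simpa [line_apply] using h.base i j
  obtain ⟨i, s, rfl⟩ := h.surjective x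
  obtain ⟨k, t, rfl⟩ := h.surjective y
  obtain ⟨s, hs0, hs1, rfl⟩ := rep s
  obtain ⟨t, ht0, ht1, rfl⟩ := rep t
  have hδ0 : 0 ≤ δ := by
    obtain ⟨c, hc0, hc, -⟩ := hxy i
    linarith
  by_cases hik : i = k
  · subst hik
    obtain ⟨c, hc0, hc, e⟩ := hxy i
    rw [h.collapse_self, h.collapse_self, one_mul, ← AddCircle.coe_add] at e
    by_cases hsc : s + c ≤ 1
    · refine ⟨l i t, ⟨i, s, c, hs0, hc0, hc, hsc, rfl, by rw [line_apply, e]⟩, i, t, 0, ht0, le_rfl,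
        hδ0, by linarith, rfl, by rw [line_apply, add_zero]⟩
    · push Not at hsc
      refine ⟨line l i 1, ⟨i, s, 1 - s, hs0, by linarith, by linarith, by linarith, rfl, ?_⟩,
        i, 0, s + c - 1, le_rfl, by linarith, by linarith, by linarith, hone i, ?_⟩
      · congr 1
        ring
      · rw [line_apply, e, zero_add, AddCircle.coe_sub, AddCircle.coe_period, sub_zero]
  · obtain ⟨c, hc0, hc, e⟩ := hxy i
    obtain ⟨d, hd0, hd, e'⟩ := hxy k
    rw [h.collapse_self, h.collapse_of_ne hik, one_mul, ← AddCircle.coe_add,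
      ← AddCircle.coe_zero] at e
    rw [h.collapse_self, h.collapse_of_ne (Ne.symm hik), one_mul, zero_add] at e'
    refine ⟨line l k 0, ?_, k, 0, d, le_rfl, hd0, hd, by linarith, rfl, ?_⟩
    -- As `y` is off the `i`-th circle or at the base point, its `i`-th coordinate is zero; hence `s
    -- + c` is `0` or `1`, and the first move ends at the base point.
    · obtain ⟨m, hm⟩ := exists_int_of_circle_eq e.symm
      have hm1 : m < 2 := by
        have : (m : ℝ) < 2 := by linarith
        exact_mod_cast this
      have hm0 : -1 < m := by
        have : (-1 : ℝ) < m := by linarith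
        exact_mod_cast this
      obtain rfl | rfl : m = 0 ∨ m = 1 := by omega
      · have hs : s = 0 := by push_cast at hm; linarith
        subst hs
        exact ⟨i, 0, 0, le_rfl, le_rfl, hδ0, by norm_num, rfl, by rw [add_zero, hbase k i]⟩
      · have hs : s + c = 1 := by push_cast at hm; linarith
        exact ⟨i, s, c, hs0, hc0, hc, hs.le, rfl, by rw [hs, hone, hbase k i]⟩
    · rw [line_apply, zero_add, e']

/-- A small move splits into two that stay within `[0, 1]` on a circle. Monotonicity gives the
direction of each image, uniform continuity bounds it by `η / 2`. -/
theorem locallyDirected_of_monotoneOn {ε : ℝ} (hε : ε = 1 ∨ ε = -1) {f : X → X}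
    (hf : ∀ i j, ∃ F : ℝ → ℝ, Continuous F ∧
      (∀ t, (F t : UnitAddCircle) = h.collapse i (f (line l j t))) ∧
      MonotoneOn (fun t => ε * F t) (Set.Icc 0 1)) : h.LocallyDirected ε f := by
  choose F hF hl hm using hf
  intro η hη
  have huc : ∀ i j, ∃ δ > 0, ∀ s ∈ Set.Icc (0 : ℝ) 1, ∀ t ∈ Set.Icc (0 : ℝ) 1, |s - t| < δ →
      |F i j s - F i j t| < η / 2 := fun i j => by
    have := isCompact_Icc.uniformContinuousOn_of_continuous (hF i j).continuousOn (s := Set.Icc 0 1)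
    obtain ⟨δ, hδ, H⟩ := Metric.uniformContinuousOn_iff.1 this (η / 2) (by positivity)
    exact ⟨δ, hδ, fun s hs t ht hst => H s hs t ht hst⟩
  choose δ hδ H using huc
  obtain ⟨d, hd0, hd⟩ : ∃ d > 0, ∀ i j, d < δ i j := by
    have hev : ∀ᶠ d in nhdsWithin (0 : ℝ) (Set.Ioi 0), ∀ i j, d < δ i j := by
      rw [Filter.eventually_all]
      intro i
      rw [Filter.eventually_all]
      exact fun j => nhdsWithin_le_nhds (eventually_lt_nhds (hδ i j))
    obtain ⟨d, hd, hd0⟩ := (hev.and self_mem_nhdsWithin).exists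
    exact ⟨d, hd0, hd⟩
  have hε2 : ε * ε = 1 := by rcases hε with rfl | rfl <;> norm_num
  have basic : ∀ (j : ι) (s c : ℝ), 0 ≤ s → 0 ≤ c → c ≤ d → s + c ≤ 1 →
      h.Moves ε (η / 2) (f (line l j s)) (f (line l j (s + c))) := by
    intro j s c hs hc hcd hsc i
    have hs1 : s ∈ Set.Icc (0 : ℝ) 1 := ⟨hs, by linarith⟩
    have hs2 : s + c ∈ Set.Icc (0 : ℝ) 1 := ⟨by linarith, hsc⟩
    have h1 := hm i j hs1 hs2 (by linarith)
    have h2 := H i j (s + c) hs2 s hs1 (by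
      rw [add_sub_cancel_left, abs_of_nonneg hc]
      exact lt_of_le_of_lt hcd (hd i j))
    refine ⟨ε * (F i j (s + c) - F i j s), by simp only at h1; linarith, ?_, ?_⟩
    · have h3 := abs_lt.1 h2
      rcases hε with rfl | rfl <;> linarith
    · rw [← hl, ← hl, ← mul_assoc, hε2, one_mul, ← AddCircle.coe_add]
      congr 1
      ring
  refine ⟨min d (1 / 4), by positivity, fun x y hxy => ?_⟩
  obtain ⟨z, ⟨i, s, c, hs, hc, hcd, hsc, rfl, rfl⟩, i', s', c', hs', hc', hcd', hsc', hz, rfl⟩ :=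
    Moves.exists_split h (lt_of_le_of_lt (min_le_right _ _) (by norm_num)) hxy
  have h1 := basic i s c hs hc (hcd.trans (min_le_left _ _)) hsc
  have h2 := basic i' s' c' hs' hc' (hcd'.trans (min_le_left _ _)) hsc'
  rw [← hz] at h2
  simpa using h1.trans h2

/-- Lifts of the coordinates of the iterates along the circles, monotone in the direction given by
a sign. -/
structure MonotoneLifts (f : X → X) (ε : ℝ) (F : ℕ → ι → ι → ℝ → ℝ) : Prop where
  continuous : ∀ k i j, Continuous (F k i j)
  lift : ∀ k i j t, (F k i j t : UnitAddCircle) = h.collapse i (f^[k] (line l j t))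
  monotone : ∀ k i j, Monotone fun t => ε ^ k * F k i j t

theorem LocallyDirected.exists_monotoneLifts {ε : ℝ} (hε : ε = 1 ∨ ε = -1) {f : C(X, X)}
    (hf : h.LocallyDirected ε f) : ∃ F, h.MonotoneLifts f ε F := by
  have key : ∀ (k : ℕ) (i j : ι), ∃ F : C(ℝ, ℝ),
      ∀ t, (F t : UnitAddCircle) = h.collapse i (f^[k] (line l j t)) := fun k i j =>
    exists_real_lift (((h.collapse i).comp (iterateMap f k)).comp (line l j))
  choose F hF using key
  refine ⟨fun k i j => F k i j, fun k i j => (F k i j).continuous, hF, fun k i j => ?_⟩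
  have hk : ε ^ k = 1 ∨ ε ^ k = -1 := by
    rcases hε with rfl | rfl
    · simp
    · exact neg_one_pow_eq_or ℝ k
  exact (hf.iterate hε k).monotone_lift hk (F k i j).continuous (hF k i j)

end IsWedge

/-! ### Entropy of maps of a wedge with monotone lifts -/

namespace IsWedge

variable {ι X : Type} [TopologicalSpace X] {l : ι → C(UnitAddCircle, X)}
variable [Fintype ι] [T2Space X] (h : IsWedge l)

/-- All coordinates of the two points differ by less than `δ`. -/
def Near (δ : ℝ) (x y : X) : Prop := ∀ i, dist (h.collapse i x) (h.collapse i y) < δ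

theorem exists_near_subset {A : Set (Set X)} (hA : ∀ a ∈ A, IsOpen a) (hA' : ⋃₀ A = Set.univ) :
    ∃ δ > 0, ∀ x, ∃ a ∈ A, ∀ y, h.Near δ x y → y ∈ a := by
  have hcs := h.compactSpace
  let _ : MetricSpace X := h.isClosedEmbedding_collapse.isEmbedding.comapMetricSpace _
  obtain ⟨δ, hδ, H⟩ := lebesgue_number_lemma_of_metric_sUnion (s := Set.univ) isCompact_univ hA
    (by rw [hA'])
  refine ⟨δ, hδ, fun x => ?_⟩
  obtain ⟨a, ha, hxa⟩ := H x (Set.mem_univ x)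
  refine ⟨a, ha, fun y hy => hxa ?_⟩
  rw [Metric.mem_ball, dist_comm]
  exact (dist_pi_lt_iff hδ).2 hy

theorem exists_near_map (f : C(X, X)) {ε : ℝ} (hε : 0 < ε) :
    ∃ δ > 0, ∀ x y, h.Near δ x y → h.Near ε (f x) (f y) := by
  have hcs := h.compactSpace
  let _ : MetricSpace X := h.isClosedEmbedding_collapse.isEmbedding.comapMetricSpace _
  obtain ⟨δ, hδ, H⟩ := Metric.uniformContinuous_iff.1
    (CompactSpace.uniformContinuous_of_continuous f.continuous) ε hε
  refine ⟨δ, hδ, fun x y hxy => ?_⟩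
  exact (dist_pi_lt_iff hε).1 (H ((dist_pi_lt_iff hδ).2 hxy))

variable {h}

theorem MonotoneLifts.abs_sub_eq {f : X → X} {ε : ℝ} (hε : ε = 1 ∨ ε = -1)
    {F : ℕ → ι → ι → ℝ → ℝ} (hF : h.MonotoneLifts f ε F) (k : ℕ) (i j : ι) {s t : ℝ}
    (hst : s ≤ t) : |F k i j t - F k i j s| = ε ^ k * F k i j t - ε ^ k * F k i j s := by
  have h1 := hF.monotone k i j hst
  have h2 : |ε ^ k| = 1 := by
    rcases hε with rfl | rfl <;> simp
  simp only at h1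
  rw [← mul_sub, ← one_mul |_|, ← h2, ← abs_mul, abs_of_nonneg]
  rw [mul_sub]
  linarith

omit [Fintype ι] [T2Space X] in
theorem exists_line_eq (h : IsWedge l) (x : X) : ∃ j, ∃ t ∈ Set.Icc (0 : ℝ) 1, x = line l j t := by
  obtain ⟨j, s, rfl⟩ := h.surjective x
  refine ⟨j, AddCircle.equivIco 1 0 s, ⟨(AddCircle.equivIco 1 0 s).2.1, ?_⟩, ?_⟩
  · simpa using (AddCircle.equivIco 1 0 s).2.2.le
  · rw [line_apply, AddCircle.coe_equivIco]

/-- An orbit-spanning set of a cardinality bounded by the total variation of the iterates. -/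
theorem MonotoneLifts.exists_spanning {f : X → X} {ε : ℝ} (hε : ε = 1 ∨ ε = -1)
    {F : ℕ → ι → ι → ℝ → ℝ} (hF : h.MonotoneLifts f ε F) {δ : ℝ} (hδ : 0 < δ) (m : ℕ) :
    ∃ P : Set X, (∀ x, ∃ y ∈ P, ∀ k < m, h.Near δ (f^[k] y) (f^[k] x)) ∧
      (P.encard : ENNReal) ≤ ENNReal.ofReal (δ⁻¹ * ∑ k ∈ Finset.range m, ∑ i, ∑ j,
        |F k i j 1 - F k i j 0| + Fintype.card ι) := by
  classical
  -- One nondecreasing function whose increments are the summed variations of all coordinates of all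
  -- iterates before time `m`. Points in the same bin of width `δ` for `Ψ` have `δ`-close orbits.
  let Ψ : ι → ℝ → ℝ := fun j t => ∑ k ∈ Finset.range m, ∑ i, ε ^ k * F k i j t
  have hΨ : ∀ j, ∀ s t, s ≤ t →
      Ψ j t - Ψ j s = ∑ k ∈ Finset.range m, ∑ i, |F k i j t - F k i j s| := by
    intro j s t hst
    simp only [Ψ, ← Finset.sum_sub_distrib, hF.abs_sub_eq hε _ _ _ hst]
  let T : ι → ℝ := fun j => Ψ j 1 - Ψ j 0
  have hT : ∀ j, 0 ≤ T j := fun j => by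
    simp only [T]
    rw [hΨ j 0 1 zero_le_one]
    positivity
  let g : ι → ℝ → ℕ := fun j t => ⌊δ⁻¹ * (Ψ j t - Ψ j 0)⌋₊
  let K : ι → ℕ := fun j => ⌊δ⁻¹ * T j⌋₊
  -- One point per bin, with the base point as default for empty bins. The extra bin on each circle
  -- produces the term `Fintype.card ι`.
  let Q : (Σ j, Fin (K j + 1)) → X := fun p =>
    if hp : ∃ t, g p.1 t = p.2 ∧ t ∈ Set.Icc (0 : ℝ) 1 then line l p.1 hp.choose else line l p.1 0
  have bin : ∀ j s t, 0 ≤ s → s ≤ t → g j s = g j t →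
      ∀ k < m, ∀ i, |F k i j t - F k i j s| < δ := by
    intro j s t hs hst hg k hk i
    have h0 : ∀ u v, u ≤ v → 0 ≤ Ψ j v - Ψ j u := fun u v huv => by
      rw [hΨ j u v huv]
      positivity
    have h1 := Nat.floor_le (mul_nonneg (inv_nonneg.2 hδ.le) (h0 0 s hs))
    have h2 := Nat.lt_floor_add_one (δ⁻¹ * (Ψ j t - Ψ j 0))
    have hg' : (⌊δ⁻¹ * (Ψ j s - Ψ j 0)⌋₊ : ℝ) = ⌊δ⁻¹ * (Ψ j t - Ψ j 0)⌋₊ := by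
      exact_mod_cast hg
    have h3 : δ⁻¹ * (Ψ j t - Ψ j s) < 1 := by linarith
    rw [inv_mul_lt_iff₀ hδ, mul_one, hΨ j s t hst] at h3
    refine lt_of_le_of_lt ?_ h3
    refine le_trans ?_ (Finset.single_le_sum (f := fun k => ∑ i, |F k i j t - F k i j s|)
      (fun k _ => by positivity) (Finset.mem_range.2 hk))
    exact Finset.single_le_sum (f := fun i => |F k i j t - F k i j s|)
      (fun i _ => by positivity) (Finset.mem_univ i)
  refine ⟨Set.range Q, fun x => ?_, ?_⟩
  · obtain ⟨j, t, ht, rfl⟩ := h.exists_line_eq x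
    have hgK : g j t < K j + 1 := by
      refine Nat.lt_succ_of_le (Nat.floor_le_floor ?_)
      refine mul_le_mul_of_nonneg_left ?_ (inv_nonneg.2 hδ.le)
      have := hΨ j t 1 ht.2
      have h2 : 0 ≤ Ψ j 1 - Ψ j t := by rw [this]; positivity
      simp only [T]
      linarith
    refine ⟨Q ⟨j, ⟨g j t, hgK⟩⟩, ⟨_, rfl⟩, fun k hk i => ?_⟩
    have hp : ∃ s, g j s = g j t ∧ s ∈ Set.Icc (0 : ℝ) 1 := ⟨t, rfl, ht⟩
    have hQ : Q ⟨j, ⟨g j t, hgK⟩⟩ = line l j hp.choose := dif_pos hp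
    obtain ⟨hs1, hs2⟩ := hp.choose_spec
    rw [hQ, ← hF.lift, ← hF.lift]
    refine lt_of_le_of_lt (circle_dist_le _ _) ?_
    rcases le_total hp.choose t with hle | hle
    · rw [abs_sub_comm]
      exact bin j _ _ hs2.1 hle hs1 k hk i
    · exact bin j _ _ ht.1 hle hs1.symm k hk i
  · have h1 : (Set.range Q).encard ≤ ((∑ j, (K j + 1) : ℕ) : ℕ∞) := by
      rw [← Set.image_univ]
      refine (Set.encard_image_le _ _).trans ?_
      rw [Set.encard_univ, ENat.card_eq_coe_fintype_card, Fintype.card_sigma]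
      simp
    have h2 : ((∑ j, (K j + 1) : ℕ) : ℝ) ≤ δ⁻¹ * ∑ k ∈ Finset.range m, ∑ i, ∑ j,
        |F k i j 1 - F k i j 0| + Fintype.card ι := by
      push_cast
      rw [Finset.sum_add_distrib, Finset.sum_const, Finset.card_univ, nsmul_eq_mul, mul_one]
      refine add_le_add ?_ le_rfl
      have h3 : ∑ k ∈ Finset.range m, ∑ i, ∑ j, |F k i j 1 - F k i j 0| = ∑ j, T j := by
        simp only [T, hΨ _ 0 1 zero_le_one]
        rw [Finset.sum_comm (s := Finset.univ) (t := Finset.range m)]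
        refine Finset.sum_congr rfl fun k _ => ?_
        rw [Finset.sum_comm]
      rw [h3, Finset.mul_sum]
      exact Finset.sum_le_sum fun j _ => Nat.floor_le (mul_nonneg (inv_nonneg.2 hδ.le) (hT j))
    refine le_trans (ENat.toENNReal_le.2 h1) ?_
    rw [ENat.toENNReal_coe, ← ENNReal.ofReal_natCast]
    exact ENNReal.ofReal_le_ofReal h2

theorem MonotoneLifts.exists_card_le {f : X → X} {ε : ℝ} (hε : ε = 1 ∨ ε = -1)
    {F : ℕ → ι → ι → ℝ → ℝ} (hF : h.MonotoneLifts f ε F) {A : Set (Set X)}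
    (hA : ∀ a ∈ A, IsOpen a) (hA' : ⋃₀ A = Set.univ) :
    ∃ C : ℝ, 0 ≤ C ∧ ∀ m, ((minSubcoverCard (iteratedCover f A m) : ℕ∞) : ENNReal) ≤
      ENNReal.ofReal (C * ∑ k ∈ Finset.range m, ∑ i, ∑ j, |F k i j 1 - F k i j 0| +
        Fintype.card ι) := by
  obtain ⟨δ, hδ, H⟩ := h.exists_near_subset hA hA'
  choose a haA ha using H
  refine ⟨δ⁻¹, by positivity, fun m => ?_⟩
  obtain ⟨P, hP, hcard⟩ := hF.exists_spanning hε hδ m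
  let U : X → Set X := fun y => ⋂ k : Fin m, f^[(k : ℕ)] ⁻¹' a (f^[(k : ℕ)] y)
  refine le_trans (ENat.toENNReal_le.2 ?_) hcard
  refine le_trans (iInf₂_le (U '' P) ⟨?_, ?_⟩) (Set.encard_image_le U P)
  · rintro _ ⟨y, -, rfl⟩
    refine ⟨⟨y, Set.mem_iInter.2 fun k => ha _ _ fun i => ?_⟩, fun k => a (f^[(k : ℕ)] y),
      fun k => haA _, rfl⟩
    rw [dist_self]
    exact hδ
  · refine Set.eq_univ_of_forall fun x => ?_
    obtain ⟨y, hy, hyx⟩ := hP x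
    exact ⟨U y, ⟨y, hy, rfl⟩, Set.mem_iInter.2 fun k => ha _ _ (hyx k k.2)⟩

/-- Induction on time. If the arc from `s` to `t` has short image at time `k`, monotonicity keeps
all its points near the image of `s`, so at time `k + 1` they are within `1 / 8` of it on the
circle. An increment above `1 / 2` would pass through exactly `1 / 2`, at circle distance `1 / 2`.
So the increment is at most `1 / 2`, and equals the circle distance. -/
theorem MonotoneLifts.abs_sub_lt {f : C(X, X)} {ε : ℝ} (hε : ε = 1 ∨ ε = -1)
    {F : ℕ → ι → ι → ℝ → ℝ} (hF : h.MonotoneLifts f ε F) {δ : ℝ}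
    (hδf : ∀ x y, h.Near δ x y → h.Near (1 / 8) (f x) (f y)) {j : ι} {s t : ℝ} (hst : s ≤ t)
    (hst' : t ≤ s + 1 / 2) {m : ℕ}
    (hm : ∀ k ≤ m, h.Near δ (f^[k] (line l j s)) (f^[k] (line l j t))) (i : ι) :
    |F m i j t - F m i j s| < δ := by
  classical
  have small : ∀ k ≤ m, ∀ i, |F k i j t - F k i j s| ≤ 1 / 2 → |F k i j t - F k i j s| < δ := by
    intro k hk i hle
    have h1 := hm k hk i
    rw [← hF.lift, ← hF.lift, dist_comm, circle_dist_eq hle] at h1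
    exact h1
  have key : ∀ k ≤ m, ∀ i, |F k i j t - F k i j s| < δ := by
    intro k
    induction k with
    | zero =>
      intro hk i
      refine small 0 hk i ?_
      have h1 : F 0 i j t - F 0 i j s = (if i = j then t else 0) - (if i = j then s else 0) := by
        refine real_lift_sub_eq (hF.continuous 0 i j) (G := fun t => if i = j then t else 0)
          (by split_ifs <;> fun_prop) (fun r => ?_) s t
        rw [hF.lift, Function.iterate_zero, id_eq, line_apply, h.collapse_eq]
        split_ifs <;> rfl
      rw [h1]
      split_ifs
      · rw [abs_of_nonneg] <;> linarith
      · norm_num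
    | succ k ih =>
      intro hk i
      have ihk := ih (by omega)
      refine small (k + 1) hk i ?_
      have hnear : ∀ r ∈ Set.Icc s t,
          dist (F (k + 1) i j s : UnitAddCircle) (F (k + 1) i j r) < 1 / 8 := by
        intro r hr
        rw [hF.lift, hF.lift, Function.iterate_succ_apply', Function.iterate_succ_apply']
        refine hδf _ _ (fun i' => ?_) i
        rw [← hF.lift, ← hF.lift, dist_comm]
        refine lt_of_le_of_lt (circle_dist_le _ _) (lt_of_le_of_lt ?_ (ihk i'))
        rw [hF.abs_sub_eq hε k i' j hr.1, hF.abs_sub_eq hε k i' j hst]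
        have := hF.monotone k i' j hr.2
        simp only at this
        linarith
      by_contra hcon
      push Not at hcon
      have hcont : ContinuousOn (fun r => |F (k + 1) i j r - F (k + 1) i j s|) (Set.Icc s t) := by
        have := hF.continuous (k + 1) i j
        fun_prop
      obtain ⟨r, hr, hr2⟩ := intermediate_value_Icc hst hcont
        (show (1 / 2 : ℝ) ∈ Set.Icc _ _ from ⟨by simp, hcon.le⟩)
      have h1 := hnear r hr
      simp only at hr2
      rw [dist_comm, circle_dist_eq hr2.le, hr2] at h1
      norm_num at h1
  exact key m le_rfl i

/-- The variation over a set covered by finitely many sets on which it is small. -/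
theorem abs_sub_le_card_mul {F : ℝ → ℝ} (hF : Continuous F) {a b : ℝ} (hab : a ≤ b) {α : Type*}
    (s : Finset α) (U : α → Set ℝ) (hU : Set.Icc a b ⊆ ⋃ u ∈ s, U u) {δ : ℝ} (hδ : 0 ≤ δ)
    (hd : ∀ u ∈ s, ∀ x ∈ U u ∩ Set.Icc a b, ∀ y ∈ U u ∩ Set.Icc a b, |F x - F y| ≤ δ) :
    |F b - F a| ≤ s.card * δ := by
  have h1 : Set.uIcc (F a) (F b) ⊆ ⋃ u ∈ s, F '' (U u ∩ Set.Icc a b) := by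
    refine (intermediate_value_uIcc hF.continuousOn).trans ?_
    rintro _ ⟨x, hx, rfl⟩
    rw [Set.uIcc_of_le hab] at hx
    obtain ⟨u, hu⟩ := Set.mem_iUnion.1 (hU hx)
    obtain ⟨hus, hxu⟩ := Set.mem_iUnion.1 hu
    exact Set.mem_biUnion hus ⟨x, ⟨hxu, hx⟩, rfl⟩
  -- The interval between the end values is covered by the images of the pieces, each of Lebesgue
  -- measure at most its diameter.
  have h2 : MeasureTheory.volume (Set.uIcc (F a) (F b)) ≤ ENNReal.ofReal (s.card * δ) := by
    calc MeasureTheory.volume (Set.uIcc (F a) (F b))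
        ≤ MeasureTheory.volume (⋃ u ∈ s, F '' (U u ∩ Set.Icc a b)) := MeasureTheory.measure_mono h1
      _ ≤ ∑ u ∈ s, MeasureTheory.volume (F '' (U u ∩ Set.Icc a b)) :=
          MeasureTheory.measure_biUnion_finset_le _ _
      _ ≤ ∑ _u ∈ s, ENNReal.ofReal δ := by
          refine Finset.sum_le_sum fun u hu => (Real.volume_le_diam _).trans ?_
          refine Metric.ediam_le ?_
          rintro _ ⟨x, hx, rfl⟩ _ ⟨y, hy, rfl⟩
          rw [edist_dist, Real.dist_eq]
          exact ENNReal.ofReal_le_ofReal (hd u hu x hx y hy)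
      _ = ENNReal.ofReal (s.card * δ) := by
          rw [Finset.sum_const, nsmul_eq_mul, ENNReal.ofReal_mul (Nat.cast_nonneg _),
            ENNReal.ofReal_natCast]
  rw [Real.volume_interval] at h2
  exact (ENNReal.ofReal_le_ofReal_iff (by positivity)).1 h2

/-- The cover consists of coordinate balls of radius `δ / 2`. By `abs_sub_lt` each member of the
refined cover meets a half circle in a set on which the lift at time `m` varies by at most `δ`.
Length `m + 1` is needed to control time `m`. -/
theorem MonotoneLifts.exists_le_card {f : C(X, X)} {ε : ℝ} (hε : ε = 1 ∨ ε = -1)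
    {F : ℕ → ι → ι → ℝ → ℝ} (hF : h.MonotoneLifts f ε F) :
    ∃ A : Set (Set X), (∀ a ∈ A, IsOpen a) ∧ ⋃₀ A = Set.univ ∧ ∃ C : ℝ, 0 < C ∧ ∀ m,
      ENNReal.ofReal (∑ i, ∑ j, |F m i j 1 - F m i j 0|) ≤
        ENNReal.ofReal C * ((minSubcoverCard (iteratedCover f A (m + 1)) : ℕ∞) : ENNReal) := by
  obtain ⟨δ, hδ, hδf⟩ := h.exists_near_map f (by norm_num : (0 : ℝ) < 1 / 8)
  let V : X → Set X := fun x => {y | h.Near (δ / 2) x y}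
  have hVV : ∀ x, ∀ y ∈ V x, ∀ z ∈ V x, h.Near δ y z := by
    intro x y hy z hz i
    have h1 := hy i
    have h2 := hz i
    have := dist_triangle_left (h.collapse i y) (h.collapse i z) (h.collapse i x)
    linarith
  -- Two half circles for each of the pairs `(i, j)`; the summand `1` ensures positivity.
  have hC : 0 < (Fintype.card ι : ℝ) * Fintype.card ι * (2 * δ) + 1 := by positivity
  refine ⟨Set.range V, ?_, ?_, _, hC, fun m => ?_⟩
  · rintro _ ⟨x, rfl⟩
    have : V x = ⋂ i, {y | dist (h.collapse i x) (h.collapse i y) < δ / 2} := by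
      ext y
      simp [V, Near]
    rw [this]
    exact isOpen_iInter_of_finite fun i => isOpen_lt (by fun_prop) continuous_const
  · refine Set.eq_univ_of_forall fun x => ⟨V x, ⟨x, rfl⟩, fun i => ?_⟩
    rw [dist_self]
    positivity
  · set C : ℝ := (Fintype.card ι : ℝ) * Fintype.card ι * (2 * δ) + 1 with hCdef
    set x : ℝ := ∑ i, ∑ j, |F m i j 1 - F m i j 0| with hx
    have hx0 : 0 ≤ x := by positivity
    have key : ((⌈x / C⌉₊ : ℕ) : ℕ∞) ≤ minSubcoverCard (iteratedCover f (Set.range V) (m + 1)) := by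
      refine le_iInf₂ fun B hB => ?_
      by_cases hfin : B.Finite
      swap
      · rw [Set.Infinite.encard_eq hfin]
        exact le_top
      rw [hfin.encard_eq_coe_toFinset_card, Nat.cast_le, Nat.ceil_le, div_le_iff₀ hC]
      have half : ∀ (a : ℝ) (i j : ι), |F m i j (a + 1 / 2) - F m i j a| ≤
          hfin.toFinset.card * δ := by
        intro a i j
        refine abs_sub_le_card_mul (hF.continuous m i j) (by linarith) hfin.toFinset
          (fun U => line l j ⁻¹' U) (fun r _ => ?_) hδ.le ?_
        · have : line l j r ∈ ⋃₀ B := hB.2 ▸ Set.mem_univ _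
          obtain ⟨U, hU, hrU⟩ := this
          exact Set.mem_biUnion (hfin.mem_toFinset.2 hU) hrU
        · have main : ∀ U ∈ B, ∀ s ∈ line l j ⁻¹' U ∩ Set.Icc a (a + 1 / 2),
              ∀ t ∈ line l j ⁻¹' U ∩ Set.Icc a (a + 1 / 2), s ≤ t →
              |F m i j t - F m i j s| ≤ δ := by
            intro U hU s hs t ht hst
            obtain ⟨-, c, hc, rfl⟩ := hB.1 hU
            refine (hF.abs_sub_lt hε hδf hst (by linarith [hs.2.1, ht.2.2]) (fun k hk => ?_) i).le
            obtain ⟨z, hz⟩ := hc ⟨k, Nat.lt_succ_of_le hk⟩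
            have h1 := Set.mem_iInter.1 hs.1 ⟨k, Nat.lt_succ_of_le hk⟩
            have h2 := Set.mem_iInter.1 ht.1 ⟨k, Nat.lt_succ_of_le hk⟩
            rw [Set.mem_preimage, ← hz] at h1 h2
            exact hVV z _ h1 _ h2
          intro U hU s hs t ht
          rw [Set.Finite.mem_toFinset] at hU
          rcases le_total s t with hst | hst
          · rw [abs_sub_comm]
            exact main U hU s hs t ht hst
          · exact main U hU t ht s hs hst
      have full : ∀ i j, |F m i j 1 - F m i j 0| ≤ 2 * δ * hfin.toFinset.card := by
        intro i j
        have h1 := half 0 i j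
        have h2 := half (1 / 2) i j
        rw [zero_add] at h1
        rw [add_halves] at h2
        have := abs_sub_le (F m i j 1) (F m i j (1 / 2)) (F m i j 0)
        linarith
      calc x ≤ ∑ _i : ι, ∑ _j : ι, 2 * δ * (hfin.toFinset.card : ℝ) :=
            Finset.sum_le_sum fun i _ => Finset.sum_le_sum fun j _ => full i j
        _ = (Fintype.card ι : ℝ) * Fintype.card ι * (2 * δ) * hfin.toFinset.card := by
            simp only [Finset.sum_const, Finset.card_univ, nsmul_eq_mul]
            ring
        _ ≤ hfin.toFinset.card * C := by
            rw [hCdef]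
            have : (0 : ℝ) ≤ hfin.toFinset.card := Nat.cast_nonneg _
            linarith
    refine le_trans ?_ (mul_le_mul_right (ENat.toENNReal_le.2 key) _)
    rw [ENat.toENNReal_coe, ← ENNReal.ofReal_natCast, ← ENNReal.ofReal_mul hC.le]
    refine ENNReal.ofReal_le_ofReal ?_
    have := Nat.le_ceil (x / C)
    rwa [div_le_iff₀' hC] at this

end IsWedge

/-! ### Maps of class `Mⁿ` are locally directed -/

/-- Continuous induction away from `0`; the end point `0`, which corresponds to `b`, is reached by a
limit. -/
theorem monotoneOn_Icc_of_eventually_le {F : ℝ → ℝ} (hF : Continuous F)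
    (h : ∀ t ∈ Set.Ioo (0 : ℝ) 1, ∀ᶠ s in nhdsWithin t (Set.Ioi t), F t ≤ F s) :
    MonotoneOn F (Set.Icc 0 1) := by
  have inner : ∀ a b : ℝ, 0 < a → a ≤ b → b ≤ 1 → F a ≤ F b := by
    intro a b ha hab hb
    have key : Set.Icc a b ⊆ {t | F a ≤ F t} := by
      refine IsClosed.Icc_subset_of_forall_exists_gt
        ((isClosed_le continuous_const hF).inter isClosed_Icc) (le_refl (F a)) ?_
      rintro x ⟨hx, hxab⟩ y hy
      have h1 : ∀ᶠ s in nhdsWithin x (Set.Ioi x), s ∈ Set.Ioc x y := Ioc_mem_nhdsGT hy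
      obtain ⟨s, hs, hs1⟩ := ((h x ⟨ha.trans_le hxab.1, hxab.2.trans_le hb⟩).and h1).exists
      exact ⟨s, le_trans hx hs, hs1⟩
    exact key ⟨hab, le_rfl⟩
  intro a ha b hb hab
  rcases ha.1.eq_or_lt with rfl | ha0
  · rcases hab.eq_or_lt with rfl | hb0
    · exact le_rfl
    · have h1 : Filter.Tendsto F (nhdsWithin 0 (Set.Ioi 0)) (nhds (F 0)) :=
        hF.continuousAt.mono_left nhdsWithin_le_nhds
      refine le_of_tendsto h1 ?_
      filter_upwards [Ioc_mem_nhdsGT hb0] with s hs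
      exact inner s b hs.1 hs.2 hb.2
  · exact inner a b ha0 hab hb.2

theorem HasDerivAt.eventually_mul_pos {φ : ℝ → ℝ} {c x : ℝ} (h : HasDerivAt φ c x) (hc : 0 < c) :
    ∃ δ > 0, ∀ u : ℝ, u ≠ 0 → |u| < δ → 0 < u * (φ (x + u) - φ x) := by
  have h1 := (hasDerivAt_iff_tendsto_slope.1 h).eventually (lt_mem_nhds hc)
  rw [eventually_nhdsWithin_iff] at h1
  obtain ⟨δ, hδ, H⟩ := Metric.eventually_nhds_iff.1 h1
  refine ⟨δ, hδ, fun u hu hud => ?_⟩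
  have h2 := H (y := x + u) (by simpa [Real.dist_eq] using hud) (by simpa using hu)
  rw [slope_def_field, add_sub_cancel_left] at h2
  have h3 : u * (φ (x + u) - φ x) = (φ (x + u) - φ x) / u * (u * u) := by
    field_simp
  rw [h3]
  exact mul_pos h2 (mul_self_pos.2 hu)

namespace IsWedge

variable {ι X : Type} [TopologicalSpace X] {l : ι → C(UnitAddCircle, X)}
variable [Finite ι] [T2Space X]

/-- On each circle the parameters at distance at least `δ` from those of `x` form a compact set; the
finite union of the images is closed and misses `x`. -/
theorem eventually_eq_line_add (h : IsWedge l) (x : X) {δ : ℝ} (hδ : 0 < δ) :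
    ∀ᶠ y in nhds x, ∃ i, ∃ r u : ℝ, line l i r = x ∧ |u| < δ ∧ y = line l i (r + u) := by
  let K : ι → Set UnitAddCircle := fun i => {s | ∀ r, l i r = x → δ ≤ dist s r}
  have hK : ∀ i, IsClosed (K i) := fun i => by
    have : K i = ⋂ r, ⋂ (_ : l i r = x), {s | δ ≤ dist s r} := by
      ext s
      simp [K]
    rw [this]
    exact isClosed_iInter fun r => isClosed_iInter fun _ =>
      isClosed_le continuous_const (by fun_prop)
  have hO : IsOpen (⋃ i, l i '' K i)ᶜ := by
    rw [isOpen_compl_iff]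
    exact isClosed_iUnion_of_finite fun i => ((hK i).isCompact.image (l i).continuous).isClosed
  have hx : x ∈ (⋃ i, l i '' K i)ᶜ := by
    intro hx
    obtain ⟨i, s, hs, hsx⟩ := Set.mem_iUnion.1 hx
    have := hs s hsx
    rw [dist_self] at this
    linarith
  filter_upwards [hO.mem_nhds hx] with y hy
  obtain ⟨i, s, rfl⟩ := h.surjective y
  have hs : s ∉ K i := fun hs => hy (Set.mem_iUnion.2 ⟨i, s, hs, rfl⟩)
  simp only [K, Set.mem_ofPred_eq, not_forall, not_le] at hs
  obtain ⟨r, hr, hsr⟩ := hs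
  obtain ⟨r, rfl⟩ := QuotientAddGroup.mk_surjective r
  obtain ⟨s, rfl⟩ := QuotientAddGroup.mk_surjective s
  change dist (s : UnitAddCircle) (r : UnitAddCircle) < δ at hsr
  rw [dist_eq_norm, ← AddCircle.coe_sub, UnitAddCircle.norm_eq] at hsr
  refine ⟨i, r, _, hr, hsr, ?_⟩
  have : r + (s - r - round (s - r)) = s - round (s - r) := by ring
  rw [this, line_apply, AddCircle.coe_sub]
  congr 1
  rw [eq_comm, sub_eq_self, AddCircle.coe_eq_zero_iff]
  exact ⟨round (s - r), by simp⟩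

end IsWedge

namespace Bouquet

variable {n : ℕ} (G : Bouquet n)

theorem isWedge : IsWedge G.loop where
  injective i s t hst := G.circle_injective i (congrArg Subtype.val hst)
  base i j := Subtype.ext ((G.circle_zero i).trans (G.circle_zero j).symm)
  eq_zero i j s t hij hst := by
    have h1 : G.circle i s = G.circle j t := congrArg Subtype.val hst
    have h2 : G.circle i s ∈ Set.range (G.circle i) ∩ Set.range (G.circle j) :=
      ⟨⟨s, rfl⟩, ⟨t, h1.symm⟩⟩
    rw [G.range_inter_range i j hij, Set.mem_singleton_iff, ← G.circle_zero i] at h2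
    exact G.circle_injective i h2
  surjective := by
    rintro ⟨_, i, s, rfl⟩
    exact ⟨i, s, rfl⟩

theorem hasDerivAt_circle (i : Fin n) (t : ℝ) :
    HasDerivAt (fun u : ℝ => G.circle i (u : UnitAddCircle)) (G.velocity i t) t :=
  (((G.contDiff_circle i).differentiable one_ne_zero) t).hasDerivAt

/-- Near a given point, the position along each circle through it is seen by the scalar product with
a vector tangent to these circles. -/
theorem exists_forall_inner_pos {ε : ℝ} (x : G.Space) {w : EuclideanSpace ℝ (Fin 2)}
    (hw : ∀ (i : Fin n) (r : ℝ), x = G.loop i (r : UnitAddCircle) →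
      ∃ D : ℝ, 0 < ε * D ∧ w = D • G.velocity i r) :
    ∃ δ > 0, ∀ (i : Fin n) (r u : ℝ), x = G.loop i (r : UnitAddCircle) → u ≠ 0 → |u| < δ →
      0 < u * (ε * inner ℝ w
        (G.circle i ((r + u : ℝ) : UnitAddCircle) - (x : EuclideanSpace ℝ (Fin 2)))) := by
  have each : ∀ i : Fin n, ∃ δ > 0, ∀ (r u : ℝ), x = G.loop i (r : UnitAddCircle) → u ≠ 0 →
      |u| < δ → 0 < u * (ε * inner ℝ w
        (G.circle i ((r + u : ℝ) : UnitAddCircle) - (x : EuclideanSpace ℝ (Fin 2)))) := by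
    intro i
    by_cases hi : ∃ r : ℝ, x = G.loop i (r : UnitAddCircle)
    swap
    · exact ⟨1, one_pos, fun r u hr => absurd ⟨r, hr⟩ hi⟩
    obtain ⟨r, hr⟩ := hi
    obtain ⟨D, hD, hwD⟩ := hw i r hr
    have hv : 0 < inner ℝ (G.velocity i r) (G.velocity i r) := by
      rw [real_inner_self_eq_norm_sq]
      have := norm_pos_iff.2 (G.deriv_circle_ne_zero i r)
      change 0 < ‖G.velocity i r‖ at this
      positivity
    have hφ : HasDerivAt (fun u : ℝ => ε * inner ℝ w (G.circle i (u : UnitAddCircle)))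
        (ε * inner ℝ w (G.velocity i r)) r := by
      have := (HasDerivAt.inner ℝ (hasDerivAt_const r w) (G.hasDerivAt_circle i r)).const_mul ε
      simpa using this
    obtain ⟨δ, hδ, H⟩ := hφ.eventually_mul_pos (by
      rw [hwD, real_inner_smul_left, ← mul_assoc]
      exact mul_pos hD hv)
    refine ⟨δ, hδ, fun r' u hr' hu hud => ?_⟩
    have hrr : (r' : UnitAddCircle) = r := G.isWedge.injective i (hr'.symm.trans hr)
    have h1 := H u hu hud
    rw [AddCircle.coe_add, hrr, ← AddCircle.coe_add, inner_sub_right, hr, mul_sub]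
    exact h1
  choose δ hδ H using each
  have hev : ∀ᶠ d in nhdsWithin (0 : ℝ) (Set.Ioi 0), ∀ i, d < δ i := by
    rw [Filter.eventually_all]
    exact fun i => nhdsWithin_le_nhds (eventually_lt_nhds (hδ i))
  obtain ⟨d, hd, hd0⟩ := (hev.and self_mem_nhdsWithin).exists
  exact ⟨d, hd0, fun i r u hr hu hud => H i r u hr hu (hud.trans (hd i))⟩

/-- Let `w` be the derivative of `f` along the circle at `t`. Just after `t` the displacement of the
image has positive scalar product with `w`, and `w` is `ε` times a positive multiple of the velocity
of every circle through the image point. So the displacement `u` along whichever circle is taken has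
the sign of `ε`, even if the image point is `b`. -/
theorem eventually_le_lift {f : C(G.Space, G.Space)} {ε : ℝ} (hε : ε = 1 ∨ ε = -1)
    {j : Fin n} {t : ℝ} (hf : ∀ (i : Fin n) (s : ℝ),
      f (G.loop j (t : UnitAddCircle)) = G.loop i (s : UnitAddCircle) →
        ∃ D : ℝ, 0 < ε * D ∧ HasDerivAt (G.along f j) (D • G.velocity i s) t)
    (k : Fin n) {F : ℝ → ℝ} (hF : Continuous F)
    (hl : ∀ s, (F s : UnitAddCircle) = G.isWedge.collapse k (f (IsWedge.line G.loop j s))) :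
    ∀ᶠ s in nhdsWithin t (Set.Ioi t), ε * F t ≤ ε * F s := by
  have hε2 : ε * ε = 1 := by rcases hε with rfl | rfl <;> norm_num
  set x : G.Space := f (G.loop j (t : UnitAddCircle)) with hx
  obtain ⟨i₀, s₀, hxs⟩ := G.isWedge.surjective x
  obtain ⟨s₀, rfl⟩ := QuotientAddGroup.mk_surjective s₀
  obtain ⟨D, hD, hder⟩ := hf i₀ s₀ hxs.symm
  set w := D • G.velocity i₀ s₀ with hw
  have hw0 : 0 < inner ℝ w w := by
    rw [real_inner_self_eq_norm_sq]
    have h1 : D ≠ 0 := by rintro rfl; simp at hD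
    have h2 : w ≠ 0 := smul_ne_zero h1 (G.deriv_circle_ne_zero i₀ s₀)
    have := norm_pos_iff.2 h2
    positivity
  obtain ⟨δ, hδ, H⟩ := G.exists_forall_inner_pos (ε := ε) x (w := w) (fun i r hr => by
    obtain ⟨D', hD', hder'⟩ := hf i r hr
    exact ⟨D', hD', hder.unique hder'⟩)
  have hφ : HasDerivAt (fun s => inner ℝ w (G.along f j s)) (inner ℝ w w) t := by
    have := HasDerivAt.inner ℝ (hasDerivAt_const t w) hder
    simpa using this
  obtain ⟨δ', hδ', H'⟩ := hφ.eventually_mul_pos hw0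
  have hd : 0 < min δ (1 / 4) := by positivity
  have hcont : ContinuousAt (fun s => f (IsWedge.line G.loop j s)) t := by fun_prop
  have e1 := hcont.eventually (G.isWedge.eventually_eq_line_add x hd)
  have e2 := hF.continuousAt.eventually (Metric.ball_mem_nhds (F t) (by norm_num : (0:ℝ) < 1 / 4))
  have e3 := Metric.ball_mem_nhds t hδ'
  filter_upwards [nhdsWithin_le_nhds e1, nhdsWithin_le_nhds e2, nhdsWithin_le_nhds e3,
    self_mem_nhdsWithin] with s hs1 hs2 hs3 hs4
  have hs4' : 0 < s - t := sub_pos.2 hs4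
  obtain ⟨i, r, u, hr, hu, hy⟩ := hs1
  have hpos : 0 < inner ℝ w (G.circle i ((r + u : ℝ) : UnitAddCircle) -
      (x : EuclideanSpace ℝ (Fin 2))) := by
    have h1 := H' (s - t) hs4'.ne' (by simpa [Real.dist_eq] using hs3)
    have h2 := (mul_pos_iff_of_pos_left hs4').1 h1
    rw [add_sub_cancel, ← inner_sub_right] at h2
    have h3 : G.along f j s = G.circle i ((r + u : ℝ) : UnitAddCircle) := congrArg Subtype.val hy
    rw [h3] at h2
    exact h2
  have hu0 : u ≠ 0 := by
    rintro rfl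
    have h1 : G.circle i ((r + 0 : ℝ) : UnitAddCircle) = (x : EuclideanSpace ℝ (Fin 2)) := by
      rw [add_zero]
      exact congrArg Subtype.val hr
    rw [h1, sub_self, inner_zero_right] at hpos
    exact lt_irrefl _ hpos
  have hεu : 0 < ε * u := by
    have h1 := H i r u hr.symm hu0 (hu.trans_le (min_le_left _ _))
    rw [← mul_assoc, mul_comm u ε] at h1
    exact (pos_iff_pos_of_mul_pos h1).2 hpos
  have hFs : F s = F t + if k = i then u else 0 := by
    refine eq_of_circle_eq ?_ ?_
    · rw [hl, hy, AddCircle.coe_add, hl]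
      change _ = G.isWedge.collapse k x + _
      rw [← hr, IsWedge.line_apply, IsWedge.line_apply, G.isWedge.collapse_eq,
        G.isWedge.collapse_eq]
      split_ifs <;> simp
    · have h1 : |F s - F t| < 1 / 4 := by simpa [Real.dist_eq] using hs2
      have h2 : |if k = i then u else 0| < 1 / 4 := by
        split_ifs
        · exact hu.trans_le (min_le_right _ _)
        · norm_num
      rw [abs_lt] at *
      constructor <;> linarith
  rw [hFs, mul_add]
  split_ifs
  · linarith
  · simp

theorem MemM.locallyDirected {f : C(G.Space, G.Space)} {ε : ℝ} (hε : ε = 1 ∨ ε = -1)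
    (hf : ∀ j, ∀ t ∈ Set.Ioo (0 : ℝ) 1, ∀ (i : Fin n) (s : ℝ),
      f (G.loop j (t : UnitAddCircle)) = G.loop i (s : UnitAddCircle) →
        ∃ D : ℝ, 0 < ε * D ∧ HasDerivAt (G.along f j) (D • G.velocity i s) t) :
    G.isWedge.LocallyDirected ε f := by
  refine G.isWedge.locallyDirected_of_monotoneOn hε fun i j => ?_
  obtain ⟨F, hF⟩ := exists_real_lift (((G.isWedge.collapse i).comp f).comp
    (IsWedge.line G.loop j))
  refine ⟨F, F.continuous, hF, monotoneOn_Icc_of_eventually_le (by fun_prop) fun t ht => ?_⟩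
  exact G.eventually_le_lift hε (hf j t ht) i F.continuous hF

end Bouquet

/-! ### Growth of matrix powers -/

section MatrixGrowth

variable {n : ℕ}

theorem entrySum_nonneg (M : Matrix (Fin n) (Fin n) ℚ) : 0 ≤ entrySum M :=
  Finset.sum_nonneg fun _ _ => Finset.sum_nonneg fun _ _ => abs_nonneg _

theorem entrySum_mul_le (M N : Matrix (Fin n) (Fin n) ℚ) :
    entrySum (M * N) ≤ entrySum M * entrySum N := by
  have h1 : ∀ k, ∑ j, |(N k j : ℝ)| ≤ entrySum N := fun k =>
    Finset.single_le_sum (f := fun k => ∑ j, |(N k j : ℝ)|)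
      (fun _ _ => Finset.sum_nonneg fun _ _ => abs_nonneg _) (Finset.mem_univ k)
  calc entrySum (M * N) ≤ ∑ i, ∑ j, ∑ k, |(M i k : ℝ)| * |(N k j : ℝ)| := by
        refine Finset.sum_le_sum fun i _ => Finset.sum_le_sum fun j _ => ?_
        rw [Matrix.mul_apply]
        push_cast
        refine (Finset.abs_sum_le_sum_abs _ _).trans (Finset.sum_le_sum fun k _ => ?_)
        rw [abs_mul]
    _ = ∑ i, ∑ k, |(M i k : ℝ)| * ∑ j, |(N k j : ℝ)| := by
        refine Finset.sum_congr rfl fun i _ => ?_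
        rw [Finset.sum_comm]
        simp only [Finset.mul_sum]
    _ ≤ ∑ i, ∑ k, |(M i k : ℝ)| * entrySum N :=
        Finset.sum_le_sum fun i _ => Finset.sum_le_sum fun k _ =>
          mul_le_mul_of_nonneg_left (h1 k) (abs_nonneg _)
    _ = entrySum M * entrySum N := by
        simp only [← Finset.sum_mul]
        rfl

/-- Nonnegative matrices all of whose columns have sum at least `1` are closed under powers. -/
theorem one_le_column_sum_pow {R : Matrix (Fin n) (Fin n) ℝ} (h0 : ∀ i j, 0 ≤ R i j)
    (h1 : ∀ j, 1 ≤ ∑ i, R i j) (m : ℕ) :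
    (∀ i j, 0 ≤ (R ^ m) i j) ∧ ∀ j, 1 ≤ ∑ i, (R ^ m) i j := by
  induction m with
  | zero =>
    refine ⟨fun i j => ?_, fun j => ?_⟩
    · rw [pow_zero, Matrix.one_apply]
      split_ifs <;> norm_num
    · simp [Matrix.one_apply]
  | succ m ih =>
    refine ⟨fun i j => ?_, fun j => ?_⟩
    · rw [pow_succ, Matrix.mul_apply]
      exact Finset.sum_nonneg fun k _ => mul_nonneg (ih.1 i k) (h0 k j)
    · simp only [pow_succ, Matrix.mul_apply]
      rw [Finset.sum_comm]
      simp only [← Finset.sum_mul]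
      refine (h1 j).trans (Finset.sum_le_sum fun k _ => ?_)
      exact le_mul_of_one_le_left (h0 k j) (ih.2 k)

/-- Up to sign `B ^ m` is a power of the nonnegative matrix `ε B`, so there is no cancellation. This
yields `σ ≥ 1`. -/
theorem one_le_entrySum_pow (hn : 1 ≤ n) {B : Matrix (Fin n) (Fin n) ℚ} {ε : ℚ}
    (hε : ε = 1 ∨ ε = -1) (h0 : ∀ i j, 0 ≤ ε * B i j) (h1 : ∀ j, 1 ≤ ∑ i, ε * B i j) (m : ℕ) :
    1 ≤ entrySum (B ^ m) := by
  let R : Matrix (Fin n) (Fin n) ℝ := (ε • B).map (Rat.castHom ℝ)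
  have hR : ∀ i j, R i j = ((ε * B i j : ℚ) : ℝ) := fun i j => rfl
  obtain ⟨-, h3⟩ := one_le_column_sum_pow (R := R)
    (fun i j => by rw [hR]; exact_mod_cast h0 i j)
    (fun j => by simp only [hR]; exact_mod_cast h1 j) m
  have hpow : ∀ i j, (R ^ m) i j = (ε : ℝ) ^ m * ((B ^ m) i j : ℝ) := by
    intro i j
    have : R ^ m = ((ε • B) ^ m).map (Rat.castHom ℝ) :=
      (map_pow (Rat.castHom ℝ).mapMatrix (ε • B) m).symm
    rw [this, smul_pow]
    simp
  have habs : |(ε : ℝ) ^ m| = 1 := by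
    rcases hε with rfl | rfl <;> simp
  let j₀ : Fin n := ⟨0, hn⟩
  calc (1 : ℝ) ≤ ∑ i, (R ^ m) i j₀ := h3 j₀
    _ ≤ ∑ i, |((B ^ m) i j₀ : ℝ)| := by
        refine Finset.sum_le_sum fun i _ => ?_
        rw [hpow, ← one_mul |_|, ← habs, ← abs_mul]
        exact le_abs_self _
    _ ≤ entrySum (B ^ m) := by
        refine Finset.sum_le_sum fun i _ => ?_
        exact Finset.single_le_sum (f := fun j => |((B ^ m) i j : ℝ)|)
          (fun _ _ => abs_nonneg _) (Finset.mem_univ j₀)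

open ExpGrowth Filter

/-- Gelfand's formula for the sum of the absolute values of the entries. -/
theorem tendsto_log_entrySum_pow (B : Matrix (Fin n) (Fin n) ℚ) :
    Tendsto (fun m : ℕ => ENNReal.log (ENNReal.ofReal (entrySum (B ^ m))) / (m : EReal)) atTop
      (nhds (ENNReal.log (⨆ μ ∈ spectrum ℂ (B.map (algebraMap ℚ ℂ)), ‖μ‖ₑ))) := by
  let _ : NormedRing (Matrix (Fin n) (Fin n) ℂ) := Matrix.linftyOpNormedRing
  let _ : NormedAlgebra ℂ (Matrix (Fin n) (Fin n) ℂ) := Matrix.linftyOpNormedAlgebra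
  have : CompleteSpace (Matrix (Fin n) (Fin n) ℂ) := FiniteDimensional.complete ℂ _
  let Bc : Matrix (Fin n) (Fin n) ℂ := B.map (algebraMap ℚ ℂ)
  let x : ℕ → ENNReal := fun m => (‖Bc ^ m‖₊ : ENNReal)
  let S : ℕ → ENNReal := fun m => ENNReal.ofReal (entrySum (B ^ m))
  have hx : Tendsto (fun m : ℕ => ENNReal.log (x m) / (m : EReal)) atTop
      (nhds (ENNReal.log (spectralRadius ℂ Bc))) := by
    have h1 := (ENNReal.continuous_log.tendsto _).comp
      (spectrum.pow_nnnorm_pow_one_div_tendsto_nhds_spectralRadius Bc)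
    refine h1.congr fun m => ?_
    simp only [Function.comp, x, ENNReal.log_rpow]
    rw [EReal.div_eq_inv_mul]
    congr 1
    rw [one_div, EReal.coe_inv, EReal.coe_natCast]
  have hnn : ∀ m i j, ‖(Bc ^ m) i j‖ = |((B ^ m) i j : ℝ)| := by
    intro m i j
    have : Bc ^ m = (B ^ m).map (algebraMap ℚ ℂ) :=
      (map_pow (algebraMap ℚ ℂ).mapMatrix B m).symm
    rw [this, Matrix.map_apply]
    have e : (algebraMap ℚ ℂ) ((B ^ m) i j) = (((B ^ m) i j : ℝ) : ℂ) := by simp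
    rw [e, Complex.norm_real, Real.norm_eq_abs]
  have hxr : ∀ m, x m = ENNReal.ofReal ‖Bc ^ m‖ := fun m => (ofReal_norm _).symm
  have row : ∀ m i, ∑ j, ‖(Bc ^ m) i j‖ ≤ ‖Bc ^ m‖ := by
    intro m i
    have h1 : ∑ j, ‖(Bc ^ m) i j‖₊ ≤ ‖Bc ^ m‖₊ := by
      rw [Matrix.linfty_opNNNorm_def]
      exact Finset.le_sup (f := fun i => ∑ j, ‖(Bc ^ m) i j‖₊) (Finset.mem_univ i)
    have h2 : ((∑ j, ‖(Bc ^ m) i j‖₊ : NNReal) : ℝ) ≤ ‖Bc ^ m‖ := by exact_mod_cast h1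
    simpa using h2
  have hxS : ∀ m, x m ≤ 1 * S m := by
    intro m
    rw [one_mul, hxr]
    refine ENNReal.ofReal_le_ofReal ?_
    have h1 : ‖Bc ^ m‖₊ ≤ (entrySum (B ^ m)).toNNReal := by
      rw [Matrix.linfty_opNNNorm_def]
      refine Finset.sup_le fun i _ => ?_
      rw [Real.le_toNNReal_iff_coe_le (entrySum_nonneg _)]
      push_cast
      simp only [hnn]
      exact Finset.single_le_sum (f := fun i => ∑ j, |((B ^ m) i j : ℝ)|)
        (fun _ _ => Finset.sum_nonneg fun _ _ => abs_nonneg _) (Finset.mem_univ i)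
    exact (Real.le_toNNReal_iff_coe_le (entrySum_nonneg _)).1 h1
  have hSx : ∀ m, S m ≤ (n : ENNReal) * x m := by
    intro m
    rw [hxr, ← ENNReal.ofReal_natCast, ← ENNReal.ofReal_mul (Nat.cast_nonneg _)]
    refine ENNReal.ofReal_le_ofReal ?_
    calc entrySum (B ^ m) ≤ ∑ _i : Fin n, ‖Bc ^ m‖ := by
          refine Finset.sum_le_sum fun i _ => ?_
          simp only [← hnn]
          exact row m i
      _ = n * ‖Bc ^ m‖ := by simp
  -- The row-sum norm and the entry sum bound each other up to the factors `1` and `n`, which do not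
  -- affect exponential growth.
  refine tendsto_of_le_liminf_of_limsup_le ?_ ?_
  · exact hx.liminf_eq.symm.le.trans
      (expGrowthInf_le_of_eventually_le ENNReal.one_ne_top (Eventually.of_forall hxS))
  · exact (expGrowthSup_le_of_eventually_le (ENNReal.natCast_ne_top n)
      (Eventually.of_forall hSx)).trans hx.limsup_eq.le

theorem eigenvalueRadius_eq {V : Type*} [AddCommGroup V] [Module ℚ V] (a : Module.Basis (Fin n) ℚ V)
    (L : V →ₗ[ℚ] V) : eigenvalueRadius L =
      ⨆ μ ∈ spectrum ℂ ((LinearMap.toMatrix a a L).map (algebraMap ℚ ℂ)), ‖μ‖ₑ := by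
  have := Module.Finite.of_basis a
  unfold eigenvalueRadius
  rw [← LinearMap.toMatrix_baseChange, LinearMap.spectrum_toMatrix]
  simp only [Module.End.hasEigenvalue_iff_mem_spectrum]

/-- A geometric series of ratio `c > 1` is bounded by a multiple of its last term, and `K` absorbs
the finitely many early terms. -/
theorem expGrowthSup_le_of_sum_bound {S N : ℕ → ENNReal} {c C D : ENNReal} (hc : 1 < c)
    (hS : ∀ᶠ k in atTop, S k ≤ c ^ k) (hS' : ∀ k, S k ≠ ⊤) (hC : C ≠ ⊤) (hD : D ≠ ⊤)
    (hN : ∀ m, N m ≤ C * ∑ k ∈ Finset.range m, S k + D) : expGrowthSup N ≤ ENNReal.log c := by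
  rcases eq_or_ne c ⊤ with rfl | hct
  · simp
  obtain ⟨k₀, hk₀⟩ := eventually_atTop.1 hS
  set K : ENNReal := 1 + ∑ k ∈ Finset.range k₀, S k with hK
  have hKt : K ≠ ⊤ := ENNReal.add_ne_top.2 ⟨ENNReal.one_ne_top,
    ENNReal.sum_ne_top.2 fun k _ => hS' k⟩
  have hbound : ∀ k, S k ≤ K * c ^ k := by
    intro k
    rcases lt_or_ge k k₀ with hk | hk
    · calc S k ≤ ∑ k ∈ Finset.range k₀, S k :=
            Finset.single_le_sum (fun _ _ => zero_le) (Finset.mem_range.2 hk)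
        _ ≤ K := le_add_self
        _ ≤ K * c ^ k := le_mul_of_one_le_right zero_le (one_le_pow₀ hc.le)
    · exact (hk₀ k hk).trans (le_mul_of_one_le_left zero_le le_self_add)
  have hgeom : ∀ m, (c - 1) * ∑ k ∈ Finset.range m, c ^ k ≤ c ^ m := by
    intro m
    induction m with
    | zero => simp
    | succ m ih =>
      rw [Finset.sum_range_succ, mul_add]
      calc _ ≤ c ^ m + (c - 1) * c ^ m := by gcongr
        _ = (1 + (c - 1)) * c ^ m := by ring
        _ = c ^ (m + 1) := by rw [add_tsub_cancel_of_le hc.le, pow_succ, mul_comm]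
  have hc1 : c - 1 ≠ 0 := (tsub_pos_of_lt hc).ne'
  have hc1' : c - 1 ≠ ⊤ := ENNReal.sub_ne_top hct
  have hgeom' : ∀ m, ∑ k ∈ Finset.range m, c ^ k ≤ (c - 1)⁻¹ * c ^ m := by
    intro m
    rw [← ENNReal.div_eq_inv_mul, ENNReal.le_div_iff_mul_le (.inl hc1) (.inl hc1'), mul_comm]
    exact hgeom m
  rw [← expGrowthSup_pow]
  refine expGrowthSup_le_of_eventually_le (b := C * (K * (c - 1)⁻¹) + D) ?_
    (Eventually.of_forall fun m => (hN m).trans ?_)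
  · exact ENNReal.add_ne_top.2 ⟨ENNReal.mul_ne_top hC (ENNReal.mul_ne_top hKt
      (ENNReal.inv_ne_top.2 hc1)), hD⟩
  · rw [add_mul]
    refine add_le_add ?_ (le_mul_of_one_le_right zero_le (one_le_pow₀ hc.le))
    rw [mul_assoc, mul_assoc]
    refine mul_le_mul_right ?_ C
    calc ∑ k ∈ Finset.range m, S k ≤ ∑ k ∈ Finset.range m, K * c ^ k :=
          Finset.sum_le_sum fun k _ => hbound k
      _ = K * ∑ k ∈ Finset.range m, c ^ k := by rw [Finset.mul_sum]
      _ ≤ _ := mul_le_mul_right (hgeom' m) K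

end MatrixGrowth

/-! ### Iterates on homology and the entropy formula -/

namespace IsWedge

variable {ι X : Type} [TopologicalSpace X] {l : ι → C(UnitAddCircle, X)}
variable [Fintype ι] [T2Space X] {h : IsWedge l}

theorem MonotoneLifts.toMatrix_pow_apply [DecidableEq ι] [Nonempty ι] {f : C(X, X)} {ε : ℝ}
    {F : ℕ → ι → ι → ℝ → ℝ} (hF : h.MonotoneLifts f ε F) {ω : RatH1 UnitAddCircle} (hω : ω ≠ 0)
    {a : Module.Basis ι ℚ (RatH1 X)} (ha : ∀ i, a i = RatH1.map (l i) ω) (m : ℕ) (i j : ι) :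
    (((LinearMap.toMatrix a a (RatH1.map f)) ^ m) i j : ℝ) = F m i j 1 - F m i j 0 := by
  have h1 : LinearMap.toMatrix a a (RatH1.map f) ^ m =
      LinearMap.toMatrix a a (RatH1.map (iterateMap f m)) := by
    rw [RatH1.map_iterateMap]
    exact (map_pow (LinearMap.toMatrixAlgEquiv a) (RatH1.map f) m).symm
  rw [h1, h.toMatrix_apply hω ha]
  exact pathWinding_eq (hF.continuous m i j) fun t => hF.lift m i j t

theorem MonotoneLifts.exists_int {f : X → X} {ε : ℝ} {F : ℕ → ι → ι → ℝ → ℝ}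
    (hF : h.MonotoneLifts f ε F) (m : ℕ) (i j : ι) : ∃ k : ℤ, F m i j 1 - F m i j 0 = k := by
  refine exists_int_of_circle_eq ?_
  rw [hF.lift, hF.lift, line_apply, line_apply, AddCircle.coe_period, AddCircle.coe_zero]

/-- If a map is not constant on the `j`-th circle, then the `j`-th circle has an image of
nonzero total winding. -/
theorem MonotoneLifts.one_le_sum {f : X → X} {ε : ℝ} (hε : ε = 1 ∨ ε = -1)
    {F : ℕ → ι → ι → ℝ → ℝ} (hF : h.MonotoneLifts f ε F) {j : ι}
    (hf : ∃ t ∈ Set.Icc (0 : ℝ) 1, f (line l j t) ≠ f (line l j 0)) :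
    1 ≤ ∑ i, ε * (F 1 i j 1 - F 1 i j 0) := by
  have hdir : ∀ i, |F 1 i j 1 - F 1 i j 0| = ε * (F 1 i j 1 - F 1 i j 0) := fun i => by
    rw [hF.abs_sub_eq hε 1 i j zero_le_one, pow_one, mul_sub]
  simp only [← hdir]
  obtain ⟨t, ht, hne⟩ := hf
  obtain ⟨i, hi⟩ : ∃ i, F 1 i j 1 - F 1 i j 0 ≠ 0 := by
    by_contra hcon
    push Not at hcon
    refine hne (h.ext fun i => ?_)
    have e : F 1 i j t = F 1 i j 0 := by
      have h1 := hF.abs_sub_eq hε 1 i j ht.1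
      have h2 := hF.monotone 1 i j ht.2
      have h3 := abs_nonneg (F 1 i j t - F 1 i j 0)
      simp only [pow_one, sub_eq_zero.1 (hcon i)] at h1 h2
      refine sub_eq_zero.1 (abs_eq_zero.1 (le_antisymm ?_ h3))
      linarith
    have h1 := hF.lift 1 i j t
    rw [e, hF.lift, Function.iterate_one] at h1
    exact h1.symm
  obtain ⟨k, hk⟩ := hF.exists_int 1 i j
  refine le_trans ?_ (Finset.single_le_sum (f := fun i => |F 1 i j 1 - F 1 i j 0|)
    (fun _ _ => abs_nonneg _) (Finset.mem_univ i))
  rw [hk] at hi ⊢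
  have hk0 : k ≠ 0 := by exact_mod_cast hi
  exact_mod_cast Int.one_le_abs hk0

end IsWedge

namespace Bouquet

variable {n : ℕ} (G : Bouquet n)

/-- A constant map would have derivative zero at the parameter `1 / 2`. -/
theorem exists_ne_of_hasDerivAt {f : C(G.Space, G.Space)} {ε : ℝ} {j : Fin n}
    (hf : ∀ t ∈ Set.Ioo (0 : ℝ) 1, ∀ (i : Fin n) (s : ℝ),
      f (G.loop j (t : UnitAddCircle)) = G.loop i (s : UnitAddCircle) →
        ∃ D : ℝ, 0 < ε * D ∧ HasDerivAt (G.along f j) (D • G.velocity i s) t) :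
    ∃ t ∈ Set.Icc (0 : ℝ) 1,
      f (IsWedge.line G.loop j t) ≠ f (IsWedge.line G.loop j 0) := by
  by_contra hcon
  push Not at hcon
  obtain ⟨i, s, hs⟩ := G.isWedge.surjective (f (G.loop j ((1 / 2 : ℝ) : UnitAddCircle)))
  obtain ⟨s, rfl⟩ := QuotientAddGroup.mk_surjective s
  obtain ⟨D, hD, hder⟩ := hf (1 / 2) (by norm_num) i s hs.symm
  have hconst : HasDerivAt (G.along f j) 0 (1 / 2) := by
    refine (hasDerivAt_const (1 / 2 : ℝ)
      (f (IsWedge.line G.loop j 0) : EuclideanSpace ℝ (Fin 2))).congr_of_eventuallyEq ?_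
    filter_upwards [Icc_mem_nhds (by norm_num : (0 : ℝ) < 1 / 2) (by norm_num : (1 / 2 : ℝ) < 1)]
      with t ht
    exact congrArg Subtype.val (hcon t ht)
  have h0 := hder.unique hconst
  rcases smul_eq_zero.1 h0 with h1 | h1
  · rw [h1, mul_zero] at hD
    exact lt_irrefl _ hD
  · exact G.deriv_circle_ne_zero i s h1

open ExpGrowth Filter

theorem topologicalEntropy_eq (hn : 1 ≤ n) {f : C(G.Space, G.Space)} (hf : G.MemM f)
    {ω : RatH1 UnitAddCircle} (hω : ω ≠ 0) {a : Module.Basis (Fin n) ℚ (RatH1 G.Space)}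
    (ha : ∀ i, a i = RatH1.map (G.loop i) ω) :
    topologicalEntropy f = ENNReal.log (eigenvalueRadius (RatH1.map f)) := by
  have : Nonempty (Fin n) := ⟨⟨0, hn⟩⟩
  obtain ⟨ε, hε, hor⟩ := hf.orientation
  obtain ⟨F, hF⟩ := IsWedge.LocallyDirected.exists_monotoneLifts G.isWedge hε
    (MemM.locallyDirected G hε hor)
  set B := LinearMap.toMatrix a a (RatH1.map f) with hB
  have hentry : ∀ m i j, ((B ^ m) i j : ℝ) = F m i j 1 - F m i j 0 :=
    hF.toMatrix_pow_apply hω ha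
  have hsum : ∀ m, ∑ i, ∑ j, |F m i j 1 - F m i j 0| = entrySum (B ^ m) := fun m => by
    simp only [entrySum, hentry]
  have hentry1 : ∀ i j, (B i j : ℝ) = F 1 i j 1 - F 1 i j 0 := fun i j => by
    rw [← hentry, pow_one]
  obtain ⟨ε', hε', hεε⟩ : ∃ ε' : ℚ, (ε' = 1 ∨ ε' = -1) ∧ (ε' : ℝ) = ε := by
    rcases hε with rfl | rfl
    · exact ⟨1, .inl rfl, by norm_num⟩
    · exact ⟨-1, .inr rfl, by norm_num⟩
  have hone : ∀ m, 1 ≤ entrySum (B ^ m) := by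
    refine one_le_entrySum_pow hn hε' (fun i j => ?_) (fun j => ?_)
    · have h1 : (0 : ℝ) ≤ (ε' * B i j : ℚ) := by
        push_cast
        rw [hentry1, hεε]
        have h2 := hF.abs_sub_eq hε 1 i j zero_le_one
        rw [pow_one, ← mul_sub] at h2
        rw [← h2]
        exact abs_nonneg _
      exact_mod_cast h1
    · have h1 : (1 : ℝ) ≤ (∑ i, ε' * B i j : ℚ) := by
        push_cast
        simp only [hentry1, hεε]
        exact hF.one_le_sum hε (G.exists_ne_of_hasDerivAt (hor j))
      exact_mod_cast h1
  set S : ℕ → ENNReal := fun m => ENNReal.ofReal (entrySum (B ^ m)) with hS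
  have hlim := tendsto_log_entrySum_pow B
  rw [hB, ← eigenvalueRadius_eq a, ← hB] at hlim
  set σ := eigenvalueRadius (RatH1.map f) with hσ
  have hSup : expGrowthSup S = ENNReal.log σ := hlim.limsup_eq
  have hσ1 : 1 ≤ σ := by
    rw [← ENNReal.zero_le_log_iff, ← hSup,
      ← expGrowthSup_const (b := 1) one_ne_zero ENNReal.one_ne_top]
    refine expGrowthSup_monotone fun m => ?_
    rw [← ENNReal.ofReal_one]
    exact ENNReal.ofReal_le_ofReal (hone m)
  refine le_antisymm (iSup₂_le fun A hA => ?_) ?_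
  · obtain ⟨C, hC, hN⟩ := hF.exists_card_le hε hA.1 hA.2
    change expGrowthSup _ ≤ _
    rw [← EReal.log_exp (expGrowthSup _), ENNReal.log_le_log_iff]
    -- It suffices to bound by every `c > σ`: then `c > 1` and eventually `S k ≤ c ^ k`, as the
    -- geometric series estimate requires.
    refine le_of_forall_gt_imp_ge_of_dense fun c hc => ?_
    rw [← ENNReal.log_le_log_iff, EReal.log_exp]
    refine expGrowthSup_le_of_sum_bound (S := S) (C := ENNReal.ofReal C) (D := Fintype.card (Fin n))
      (hσ1.trans_lt hc) ?_ (fun _ => ENNReal.ofReal_ne_top) ENNReal.ofReal_ne_top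
      (ENNReal.natCast_ne_top _) fun m => (hN m).trans ?_
    · have h1 : expGrowthSup S < ENNReal.log c := by
        rw [hSup]
        exact ENNReal.log_lt_log_iff.2 hc
      filter_upwards [eventually_le_exp h1] with k hk
      rwa [mul_comm, EReal.exp_nmul, ENNReal.exp_log] at hk
    · simp only [hsum]
      rw [ENNReal.ofReal_add (mul_nonneg hC (Finset.sum_nonneg fun k _ => entrySum_nonneg _))
        (Nat.cast_nonneg _), ENNReal.ofReal_mul hC, ENNReal.ofReal_natCast,
        ENNReal.ofReal_sum_of_nonneg fun k _ => entrySum_nonneg _]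
  · obtain ⟨A, hA, hA', C, hC, hN⟩ := hF.exists_le_card hε
    refine le_trans ?_ (le_iSup₂ (f := fun (A : Set (Set G.Space))
      (_ : (∀ a ∈ A, IsOpen a) ∧ ⋃₀ A = Set.univ) => coverEntropyOf f A) A ⟨hA, hA'⟩)
    rw [← hSup]
    change _ ≤ expGrowthSup _
    refine expGrowthSup_le_of_eventually_le
      (b := ENNReal.ofReal (entrySum B) * ENNReal.ofReal C)
      (ENNReal.mul_ne_top ENNReal.ofReal_ne_top ENNReal.ofReal_ne_top) ?_
    filter_upwards [eventually_ge_atTop 1] with m hm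
    obtain ⟨k, rfl⟩ := Nat.exists_eq_add_of_le' hm
    -- The refined cover of length `k + 1` bounds `S k`; submultiplicativity makes up for the shift
    -- of index at the cost of a constant.
    have h1 : S (k + 1) ≤ ENNReal.ofReal (entrySum B) * S k := by
      simp only [hS]
      rw [← ENNReal.ofReal_mul (entrySum_nonneg _), pow_succ']
      exact ENNReal.ofReal_le_ofReal (entrySum_mul_le _ _)
    refine h1.trans ?_
    rw [mul_assoc]
    refine mul_le_mul_right ?_ _
    have h2 := hN k
    rw [hsum] at h2
    exact h2

end Bouquet

end

theorem mainTheorem2 (n : ℕ) (hn : 1 ≤ n) (G : Bouquet n) (f : C(G.Space, G.Space))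
    (hf : G.MemM f) :
    (∀ ω : RatH1 UnitAddCircle, ω ≠ 0 →
      ∃ a : Module.Basis (Fin n) ℚ (RatH1 G.Space),
        (∀ i, a i = RatH1.map (G.loop i) ω) ∧
        Filter.Tendsto
          (fun m : ℕ =>
            ENNReal.log (ENNReal.ofReal (entrySum (LinearMap.toMatrix a a (RatH1.map f) ^ m))) /
              (m : EReal))
          Filter.atTop (nhds (topologicalEntropy f))) ∧
    topologicalEntropy f = ENNReal.log (eigenvalueRadius (RatH1.map f)) := by
  have : Nonempty (Fin n) := ⟨⟨0, hn⟩⟩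
  constructor
  · intro ω hω
    obtain ⟨a, ha⟩ := G.isWedge.exists_basis hω
    refine ⟨a, ha, ?_⟩
    rw [G.topologicalEntropy_eq hn hf hω ha, eigenvalueRadius_eq a]
    exact tendsto_log_entrySum_pow _
  · obtain ⟨ω, hω⟩ := exists_circle_class_ne_zero
    obtain ⟨a, ha⟩ := G.isWedge.exists_basis hω
    exact G.topologicalEntropy_eq hn hf hω ha
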